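/- Let $\mathcal H$ be a complex Hilbert space with $\dim\mathcal H=2$, let $\{\rho_\theta\}_{\theta\in\Theta}$, $\Theta\subset\mathbb R^2$ open, be a smooth family of density operators on $\mathcal H$, and let $\theta_0\in\Theta$ be such that $\rho:=\rho_{\theta_0}>0$ and $\partial_1\rho,\partial_2\rho$ (the partial derivatives at $\theta_0$) are linearly independent over $\mathbb R$. Let $G$ be a real positive definite $2\times 2$ matrix. For $\beta\in[0,1]$ let $L_i^{(\beta)}$ be the unique solution of $\partial_i\rho=\frac{1+\beta}2\rho L_i^{(\beta)}+\frac{1-\beta}2L_i^{(\beta)}\rho$, and put $L_i^{(S)}=L_i^{(0)}$, $L_i^{(R)}=L_i^{(1)}$, $J^{(\beta)}=[\operatorname{Tr}(\partial_i\rho)L_j^{(\beta)}]_{ij}$, $J^{(S)}=[\operatorname{Re}\operatorname{Tr}\rho L_i^{(S)}L_j^{(S)}]_{ij}$, $J^{(R)}=[\operatorname{Tr}L_i^{(R)*}\rho L_j^{(R)}]_{ij}$. For operators $B=(B_1,B_2)$ put $Z(B)=[\operatorname{Tr}\rho B_jB_i]_{ij}$, and let $L^{S,i}=\sum_j (J^{(S)^{-1}})_{ij}L_j^{(S)}$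 be the dual SLDs. For a complex Hermitian $2\times2$ matrix $J$ with entrywise real and imaginary parts $\operatorname{Re}J$, $\operatorname{Im}J$ write $c_G(J)=\operatorname{Tr}GJ+\operatorname{Tr}\bigl|\sqrt G\,\operatorname{Im}J\,\sqrt G\bigr|$ with $|X|=\sqrt{X^*X}$, and define $$C^{(S)}=\operatorname{Tr}GJ^{(S)^{-1}},\quad C^{(R)}=c_G\bigl(J^{(R)^{-1}}\bigr),\quad C^{(\beta)}=c_G\bigl(J^{(\beta)^{-1}}\bigr),\quad C^{(Z)}=c_G\bigl(Z(L^{S,1},L^{S,2})\bigr),$$ $$S_{\theta_0,G}=\frac{\bigl[\frac12(C^{(Z)}+C^{(S)})-C^{(R)}\bigr]^2}{C^{(Z)}-C^{(R)}},\qquad \hat\beta=\begin{cases}\dfrac{\operatorname{Tr}|\sqrt G\operatorname{Im}J^{(R)^{-1}}\sqrt G|}{2\operatorname{Tr}G\{J^{(S)^{-1}}-\operatorname{Re}J^{(R)^{-1}}\}}&\text{if }J^{(S)^{-1}}\ne\operatorname{Re}J^{(R)^{-1}},\\ \infty&\text{otherwise.}\end{cases}$$ Let $C^{(H)}$ be the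 Holevo bound, the infimum of $\operatorname{Tr}GV$ over all real $2\times 2$ matrices $V$ and all Hermitian operators $B_1,B_2$ on $\mathcal H$ with $V\ge Z(B)$ and $\operatorname{Tr}(\partial_i\rho)B_j=\delta_{ij}$. Then the infimum defining $C^{(H)}$ is attained, and $C^{(H)}=\max_{0\le\beta\le1}C^{(\beta)}$, which equals $C^{(1)}$ if $\hat\beta\ge1$ and $C^{(\hat\beta)}$ if $\hat\beta<1$. Moreover $\hat\beta\ge1$ if and only if $C^{(R)}\ge\frac12(C^{(Z)}+C^{(S)})$; $C^{(1)}=C^{(R)}$; and if $\hat\beta<1$ then $C^{(Z)}>C^{(R)}$ and $C^{(\hat\beta)}=C^{(R)}+S_{\theta_0,G}$. Consequently (Suzuki's formula) $$C^{(H)}=\begin{cases}C^{(R)}&\text{if }C^{(R)}\ge\frac12\bigl(C^{(Z)}+C^{(S)}\bigr),\\ C^{(R)}+S_{\theta_0,G}&\text{otherwise.}\end{cases}$$ -/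

import Mathlib

namespace QuantumEstimation

noncomputable section

open Set
open scoped ComplexOrder MatrixOrder ContDiff

variable {H : Type*} [NormedAddCommGroup H] [InnerProductSpace ℂ H]
variable {d : ℕ}

/-- The trace of an operator on a finite dimensional Hilbert space. -/
def opTrace (A : H →L[ℂ] H) : ℂ := LinearMap.trace ℂ H (A : H →ₗ[ℂ] H)

/-- The superoperator `X ↦ (1+β)/2 · ρ X + (1-β)/2 · X ρ`. -/
def betaMul (ρ : H →L[ℂ] H) (β : ℝ) : Module.End ℂ (H →L[ℂ] H) :=
  (((1 + β) / 2 : ℝ) : ℂ) • LinearMap.mulLeft ℂ ρ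
    + (((1 - β) / 2 : ℝ) : ℂ) • LinearMap.mulRight ℂ ρ

theorem betaMul_apply (ρ : H →L[ℂ] H) (β : ℝ) (X : H →L[ℂ] H) :
    betaMul ρ β X
      = (((1 + β) / 2 : ℝ) : ℂ) • (ρ * X) + (((1 - β) / 2 : ℝ) : ℂ) • (X * ρ) := rfl

variable [CompleteSpace H]

/-- A density operator: a positive operator of trace one. -/
def IsDensityOperator (A : H →L[ℂ] H) : Prop := A.IsPositive ∧ opTrace A = 1

/-- A smooth `d`-parameter family of density operators `ρ_θ`, `θ ∈ Θ ⊆ ℝ^d`, `Θ` open. -/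
structure QuantumModel (d : ℕ) (H : Type*) [NormedAddCommGroup H] [InnerProductSpace ℂ H]
    [CompleteSpace H] where
  /-- the parameter set `Θ` -/
  params : Set (Fin d → ℝ)
  isOpen_params : IsOpen params
  /-- the family `θ ↦ ρ_θ` -/
  state : (Fin d → ℝ) → (H →L[ℂ] H)
  smooth : ContDiffOn ℝ ∞ state params
  isDensity : ∀ θ ∈ params, IsDensityOperator (state θ)

namespace QuantumModel

/-- The partial derivative `∂_i ρ` at `θ`. -/
def pderiv (M : QuantumModel d H) (θ : Fin d → ℝ) (i : Fin d) : H →L[ℂ] H :=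
  lineDeriv ℝ M.state θ (Pi.single i 1)

/-- The `β` logarithmic derivative `L_i^{(β)}`: the solution `L` of
`∂_i ρ = (1+β)/2 · ρ L + (1-β)/2 · L ρ`, unique when `ρ > 0` and `-1 ≤ β ≤ 1`
(see `pderiv_eq_iff_eq_logDeriv`). -/
def logDeriv (M : QuantumModel d H) (θ : Fin d → ℝ) (β : ℝ) (i : Fin d) : H →L[ℂ] H :=
  Ring.inverse (betaMul (M.state θ) β) (M.pderiv θ i)

/-- Symmetric logarithmic derivative, `∂_i ρ = (ρ L + L ρ)/2`. -/
def sld (M : QuantumModel d H) (θ : Fin d → ℝ) (i : Fin d) : H →L[ℂ] H := M.logDeriv θ 0 i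

/-- Right logarithmic derivative, `∂_i ρ = ρ L`. -/
def rld (M : QuantumModel d H) (θ : Fin d → ℝ) (i : Fin d) : H →L[ℂ] H := M.logDeriv θ 1 i

/-- The SLD Fisher information matrix `[Re Tr ρ L_i L_j]`. -/
def fisherS (M : QuantumModel d H) (θ : Fin d → ℝ) : Matrix (Fin d) (Fin d) ℝ :=
  Matrix.of fun i j => (opTrace (M.state θ * M.sld θ i * M.sld θ j)).re

/-- The RLD Fisher information matrix `[Tr L_i^* ρ L_j]`. -/
def fisherR (M : QuantumModel d H) (θ : Fin d → ℝ) : Matrix (Fin d) (Fin d) ℂ :=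
  Matrix.of fun i j => opTrace (star (M.rld θ i) * M.state θ * M.rld θ j)

/-- The `β` Fisher information matrix `[Tr (∂_i ρ) L_j^{(β)}]`. -/
def fisherBeta (M : QuantumModel d H) (θ : Fin d → ℝ) (β : ℝ) : Matrix (Fin d) (Fin d) ℂ :=
  Matrix.of fun i j => opTrace (M.pderiv θ i * M.logDeriv θ β j)

/-- `Z_{ij}(B) = Tr ρ B_j B_i`. -/
def Z (M : QuantumModel d H) (θ : Fin d → ℝ) (B : Fin d → (H →L[ℂ] H)) :
    Matrix (Fin d) (Fin d) ℂ :=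
  Matrix.of fun i j => opTrace (M.state θ * B j * B i)

/-- The dual SLDs `L^{S,i} = ∑_j ((J^{(S)})⁻¹)_{ij} L_j^{(S)}`. -/
def dualSLD (M : QuantumModel d H) (θ : Fin d → ℝ) (i : Fin d) : H →L[ℂ] H :=
  ∑ j, (((M.fisherS θ)⁻¹ i j : ℝ) : ℂ) • M.sld θ j

end QuantumModel

/-- `Tr |√G X √G|` for real matrices `G` and `X`, with `|Y| = √(Y^* Y)`. -/
def traceAbs (G X : Matrix (Fin d) (Fin d) ℝ) : ℝ :=
  (CFC.abs (CFC.sqrt G * X * CFC.sqrt G)).trace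

/-- `Tr G J + Tr |√G (Im J) √G|`, with the entrywise imaginary part `Im J`; the first term is real
when `J` is Hermitian. -/
def weightedBound (G : Matrix (Fin d) (Fin d) ℝ) (J : Matrix (Fin d) (Fin d) ℂ) : ℝ :=
  (G.map Complex.ofReal * J).trace.re + traceAbs G (J.map Complex.im)

namespace QuantumModel

/-- The SLD bound. -/
def CS (M : QuantumModel d H) (θ : Fin d → ℝ) (G : Matrix (Fin d) (Fin d) ℝ) : ℝ :=
  (G * (M.fisherS θ)⁻¹).trace

/-- The RLD bound. -/
def CR (M : QuantumModel d H) (θ : Fin d → ℝ) (G : Matrix (Fin d) (Fin d) ℝ) : ℝ :=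
  weightedBound G (M.fisherR θ)⁻¹

/-- The `β` logarithmic derivative bound. -/
def Cbeta (M : QuantumModel d H) (θ : Fin d → ℝ) (G : Matrix (Fin d) (Fin d) ℝ) (β : ℝ) : ℝ :=
  weightedBound G (M.fisherBeta θ β)⁻¹

/-- The bound obtained from the dual SLDs. -/
def CZ (M : QuantumModel d H) (θ : Fin d → ℝ) (G : Matrix (Fin d) (Fin d) ℝ) : ℝ :=
  weightedBound G (M.Z θ (M.dualSLD θ))

/-- Suzuki's correction term. -/
def suzukiS (M : QuantumModel d H) (θ : Fin d → ℝ) (G : Matrix (Fin d) (Fin d) ℝ) : ℝ :=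
  (1 / 2 * (M.CZ θ G + M.CS θ G) - M.CR θ G) ^ 2 / (M.CZ θ G - M.CR θ G)

/-- The values `Tr G V` over all feasible points `(V, B)` of the Holevo minimization problem. -/
def holevoValues (M : QuantumModel d H) (θ : Fin d → ℝ) (G : Matrix (Fin d) (Fin d) ℝ) : Set ℝ :=
  {c | ∃ (V : Matrix (Fin d) (Fin d) ℝ) (B : Fin d → (H →L[ℂ] H)),
    (∀ j, IsSelfAdjoint (B j)) ∧
    (∀ i j, opTrace (M.pderiv θ i * B j) = if i = j then 1 else 0) ∧
    (V.map Complex.ofReal - M.Z θ B).PosSemidef ∧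
    c = (G * V).trace}

/-- The Holevo bound. -/
def holevoBound (M : QuantumModel d H) (θ : Fin d → ℝ) (G : Matrix (Fin d) (Fin d) ℝ) : ℝ :=
  sInf (M.holevoValues θ G)

open Classical in
/-- The value `β̂ ∈ [0, ∞]`. -/
def betaHat (M : QuantumModel d H) (θ : Fin d → ℝ) (G : Matrix (Fin d) (Fin d) ℝ) : EReal :=
  if (M.fisherS θ)⁻¹ ≠ (M.fisherR θ)⁻¹.map Complex.re then
    ((traceAbs G ((M.fisherR θ)⁻¹.map Complex.im)
      / (2 * (G * ((M.fisherS θ)⁻¹ - (M.fisherR θ)⁻¹.map Complex.re)).trace) : ℝ) : EReal)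
  else ⊤

end QuantumModel

/-- For `ρ > 0` and `-1 ≤ β ≤ 1` the superoperator `betaMul ρ β` is invertible. -/
theorem isUnit_betaMul [FiniteDimensional ℂ H] {ρ : H →L[ℂ] H} (hρ : IsStrictlyPositive ρ)
    {β : ℝ} (hβ : β ∈ Icc (-1 : ℝ) 1) : IsUnit (betaMul ρ β) := by
  have hpos : ρ.IsPositive := (ContinuousLinearMap.nonneg_iff_isPositive ρ).1 hρ.nonneg
  obtain ⟨u, hu⟩ := hρ.isUnit
  have hq0 : ∀ x, (inner ℂ x (ρ x)).re = 0 → x = 0 := by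
    intro x hx
    have hs : CFC.sqrt ρ * CFC.sqrt ρ = ρ := CFC.sqrt_mul_sqrt_self ρ hρ.nonneg
    have hsp : (CFC.sqrt ρ).IsPositive :=
      (ContinuousLinearMap.nonneg_iff_isPositive _).1 (CFC.sqrt_nonneg ρ)
    have hx1 : ρ x = CFC.sqrt ρ (CFC.sqrt ρ x) := by
      conv_lhs => rw [← hs]
      rfl
    have h1 : (inner ℂ x (ρ x)).re = ‖CFC.sqrt ρ x‖ ^ 2 := by
      have h2 : inner ℂ x (ρ x) = inner ℂ (CFC.sqrt ρ x) (CFC.sqrt ρ x) := by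
        rw [hx1]; exact (hsp.isSymmetric x (CFC.sqrt ρ x)).symm
      rw [h2]; exact inner_self_eq_norm_sq (𝕜 := ℂ) _
    rw [h1] at hx
    have h3 : CFC.sqrt ρ x = 0 := by simpa using hx
    have h4 : ρ x = 0 := by rw [hx1, h3, map_zero]
    have h5 : ((↑u⁻¹ : H →L[ℂ] H) * ρ) x = x := by rw [← hu, Units.inv_mul]; rfl
    rw [← h5, mul_apply_eq_comp, h4, map_zero]
  rw [LinearMap.isUnit_iff_ker_eq_bot, LinearMap.ker_eq_bot']
  intro X hX
  let b := stdOrthonormalBasis ℂ H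
  have hq : ∀ x, 0 ≤ (inner ℂ x (ρ x)).re := fun x => hpos.re_inner_nonneg_right x
  have hT : ∀ A : H →L[ℂ] H, opTrace (star A * ρ * A) = ∑ i, inner ℂ (A (b i)) (ρ (A (b i))) := by
    intro A
    rw [opTrace, LinearMap.trace_eq_sum_inner _ b]
    refine Finset.sum_congr rfl fun i _ => ?_
    exact ContinuousLinearMap.adjoint_inner_right A (b i) (ρ (A (b i)))
  have hz : ∀ A : H →L[ℂ] H, (opTrace (star A * ρ * A)).re = 0 → A = 0 := by
    intro A hA
    rw [hT, Complex.re_sum, Finset.sum_eq_zero_iff_of_nonneg fun i _ => hq _] at hA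
    refine ContinuousLinearMap.coe_injective (b.toBasis.ext fun i => ?_)
    simpa using hq0 _ (hA i (Finset.mem_univ i))
  have hn : ∀ A : H →L[ℂ] H, 0 ≤ (opTrace (star A * ρ * A)).re := by
    intro A
    rw [hT, Complex.re_sum]
    exact Finset.sum_nonneg fun i _ => hq _
  have hcyc : opTrace (star X * (X * ρ)) = opTrace (star (star X) * ρ * star X) := by
    rw [star_star, mul_assoc]
    have h1 : opTrace (star X * (X * ρ)) = opTrace (X * ρ * star X) :=
      LinearMap.trace_mul_comm ℂ (star X : H →L[ℂ] H).toLinearMap (X * ρ).toLinearMap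
    rw [h1, mul_assoc]
  have hlin : (((1 + β) / 2 : ℝ) : ℂ) * opTrace (star X * ρ * X)
      + (((1 - β) / 2 : ℝ) : ℂ) * opTrace (star (star X) * ρ * star X) = 0 := by
    rw [← hcyc]
    have h1 : opTrace (star X * betaMul ρ β X) = 0 := by rw [hX]; simp [opTrace]
    rw [betaMul_apply, mul_add, mul_smul_comm, mul_smul_comm, ← mul_assoc (star X) ρ X] at h1
    simpa [opTrace] using h1
  have hre := congrArg Complex.re hlin
  rw [Complex.add_re, Complex.re_ofReal_mul, Complex.re_ofReal_mul, Complex.zero_re] at hre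
  have h1 := hn X
  have h2 := hn (star X)
  by_cases hb : β = -1
  · subst hb
    have : star X = 0 := hz _ (by linarith)
    simpa using this
  · have hb1 : 0 < (1 + β) / 2 := by
      have := lt_of_le_of_ne hβ.1 (Ne.symm hb)
      linarith
    have hb2 : 0 ≤ (1 - β) / 2 := by linarith [hβ.2]
    refine hz X ?_
    have h3 := mul_nonneg hb1.le h1
    have h4 := mul_nonneg hb2 h2
    have h5 : (1 + β) / 2 * (opTrace (star X * ρ * X)).re = 0 := by linarith
    exact (mul_eq_zero.1 h5).resolve_left hb1.ne'

/-- The defining equation of the `β` logarithmic derivatives, with existence and uniqueness. -/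
theorem QuantumModel.pderiv_eq_iff_eq_logDeriv [FiniteDimensional ℂ H] (M : QuantumModel d H)
    {θ : Fin d → ℝ} (hρ : IsStrictlyPositive (M.state θ)) {β : ℝ} (hβ : β ∈ Icc (-1 : ℝ) 1)
    (i : Fin d) (L : H →L[ℂ] H) :
    M.pderiv θ i = (((1 + β) / 2 : ℝ) : ℂ) • (M.state θ * L)
        + (((1 - β) / 2 : ℝ) : ℂ) • (L * M.state θ) ↔ L = M.logDeriv θ β i := by
  have hu := isUnit_betaMul hρ hβ
  rw [← betaMul_apply]
  constructor
  · intro h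
    rw [QuantumModel.logDeriv, h, ← Module.End.mul_apply, Ring.inverse_mul_cancel _ hu]
    rfl
  · rintro rfl
    rw [QuantumModel.logDeriv, ← Module.End.mul_apply, Ring.mul_inverse_cancel _ hu]
    rfl

end

end QuantumEstimation

namespace QuantumEstimation

open Set
open scoped ComplexOrder MatrixOrder ContDiff

variable {H : Type*} [NormedAddCommGroup H] [InnerProductSpace ℂ H] [CompleteSpace H]

/-! ### Real positive definite weights of size two -/

/-! In an eigenbasis of the state, ρ = (1 + r σ₃)/2 with r² < 1 and ∂_i ρ = u_i·σ/2, where u_i =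
(x_i, y_i, z_i). Local unbiasedness only constrains the vector parts of B_0, B_1, and it fixes them
up to multiples v_0, v_1 of the normal n = u_0 × u_1 (`exists_eq_b`). The scalar parts are best
chosen so that Tr ρ B_j = 0. Then Re Z = J_S⁻¹ + K v vᵀ, while Im Z is affine in v (`metric_b`,
`cross_b`). Minimizing over V turns Im Z into the term 2 √(det G) |·| (`le_trace_of_hermMat_le`,
`exists_hermMat_le`). The Holevo problem thus becomes the minimization of `objective`, a quadratic
form plus the absolute value of an affine function, over v ∈ ℝ².

In the same coordinates C^(β) = cS + β T - β² Q with T = `imTerm` and Q = `reTerm` (`Cbeta_eq`).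
This is a dual function: weighting the absolute value by β ≤ 1 and applying Cauchy–Schwarz bounds
the objective below by C^(β) (`le_objective`). Equality holds for a v proportional to adj(G) z if β
is the vertex T/(2Q), or if β = 1 lies at or before the vertex (`exists_objective_eq`). So the
minimum is the maximum of a concave parabola on [0, 1]. Suzuki's formula follows from C^(S) = cS,
C^(Z) = cS + T and C^(R) = cS + T - Q. -/

theorem weight_symm {G : Matrix (Fin 2) (Fin 2) ℝ} (hG : G.PosDef) : G 1 0 = G 0 1 := by
  simpa using hG.isHermitian.apply 0 1

theorem weight_det {G : Matrix (Fin 2) (Fin 2) ℝ} (hG : G.PosDef) :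
    G.det = G 0 0 * G 1 1 - G 0 1 ^ 2 := by
  rw [Matrix.det_fin_two, weight_symm hG, sq]

theorem weight_quadratic_nonneg {G : Matrix (Fin 2) (Fin 2) ℝ} (hG : G.PosDef) (a b : ℝ) :
    0 ≤ G 0 0 * a ^ 2 + 2 * G 0 1 * a * b + G 1 1 * b ^ 2 := by
  have h0 : 0 < G 0 0 := hG.diag_pos
  have hd := hG.det_pos
  rw [weight_det hG] at hd
  have h : G 0 0 * (G 0 0 * a ^ 2 + 2 * G 0 1 * a * b + G 1 1 * b ^ 2)
      = (G 0 0 * a + G 0 1 * b) ^ 2 + (G 0 0 * G 1 1 - G 0 1 ^ 2) * b ^ 2 := by ring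
  refine nonneg_of_mul_nonneg_right ?_ h0
  rw [h]
  positivity

theorem weight_quadratic_eq_zero {G : Matrix (Fin 2) (Fin 2) ℝ} (hG : G.PosDef) {a b : ℝ}
    (h : G 0 0 * a ^ 2 + 2 * G 0 1 * a * b + G 1 1 * b ^ 2 = 0) : a = 0 ∧ b = 0 := by
  have h0 : 0 < G 0 0 := hG.diag_pos
  have hd := hG.det_pos
  rw [weight_det hG] at hd
  have h1 : (G 0 0 * a + G 0 1 * b) ^ 2 + (G 0 0 * G 1 1 - G 0 1 ^ 2) * b ^ 2 = 0 := by
    linear_combination G 0 0 * h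
  have h2 : (G 0 0 * G 1 1 - G 0 1 ^ 2) * b ^ 2 = 0 := by
    have := mul_nonneg hd.le (sq_nonneg b)
    linarith [sq_nonneg (G 0 0 * a + G 0 1 * b)]
  have hb : b = 0 := by simpa [hd.ne'] using h2
  subst hb
  refine ⟨?_, rfl⟩
  simpa [h0.ne'] using h

/-- The second factor is the form of adj G = (det G) G⁻¹, dual to that of G; the deficit is a single
square. -/
theorem weight_cauchy_schwarz {G : Matrix (Fin 2) (Fin 2) ℝ} (hG : G.PosDef) (a b x y : ℝ) :
    G.det * (a * x + b * y) ^ 2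
      ≤ (G 0 0 * a ^ 2 + 2 * G 0 1 * a * b + G 1 1 * b ^ 2)
        * (G 1 1 * x ^ 2 - 2 * G 0 1 * x * y + G 0 0 * y ^ 2) := by
  rw [weight_det hG]
  have h : (G 0 0 * a ^ 2 + 2 * G 0 1 * a * b + G 1 1 * b ^ 2)
        * (G 1 1 * x ^ 2 - 2 * G 0 1 * x * y + G 0 0 * y ^ 2)
      - (G 0 0 * G 1 1 - G 0 1 ^ 2) * (a * x + b * y) ^ 2
      = (G 0 0 * a * y + G 0 1 * (b * y - a * x) - G 1 1 * b * x) ^ 2 := by ring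
  linarith [sq_nonneg (G 0 0 * a * y + G 0 1 * (b * y - a * x) - G 1 1 * b * x)]

/-- `Tr |√G (k ε) √G| = 2 √(det G) |k|` for the antisymmetric matrix `ε`. -/
theorem traceAbs_antisymm {G : Matrix (Fin 2) (Fin 2) ℝ} (hG : G.PosDef) (k : ℝ) :
    traceAbs G !![0, k; -k, 0] = 2 * √G.det * |k| := by
  set S := CFC.sqrt G with hS
  have hS0 : S.PosSemidef := Matrix.nonneg_iff_posSemidef.1 (CFC.sqrt_nonneg G)
  have hSS : S * S = G := CFC.sqrt_mul_sqrt_self G (Matrix.nonneg_iff_posSemidef.2 hG.posSemidef)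
  have hdet : S.det = √G.det := by
    rw [← hSS, Matrix.det_mul, Real.sqrt_mul_self hS0.det_nonneg]
  have hsym : S 1 0 = S 0 1 := by simpa using hS0.isHermitian.apply 0 1
  -- A symmetric S satisfies S ε S = (det S) ε, and ε* ε = 1 makes the modulus scalar.
  have h1 : S * !![0, k; -k, 0] * S = !![0, k * √G.det; -(k * √G.det), 0] := by
    rw [← hdet, Matrix.det_fin_two]
    ext i j
    fin_cases i <;> fin_cases j <;>
      simp [Matrix.mul_apply, Fin.sum_univ_two, hsym] <;> ring
  have h2 : CFC.abs (S * !![0, k; -k, 0] * S) = |k * √G.det| • (1 : Matrix (Fin 2) (Fin 2) ℝ) := by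
    rw [h1, CFC.abs]
    refine CFC.sqrt_unique ?_ ?_
    · ext i j
      have h3 : |k * √G.det| * |k * √G.det| = k * √G.det * (k * √G.det) := abs_mul_abs_self _
      fin_cases i <;> fin_cases j <;>
        simp [Matrix.mul_apply, Fin.sum_univ_two, Matrix.star_eq_conjTranspose] <;>
        simpa using h3
    · exact Matrix.nonneg_iff_posSemidef.2 (Matrix.PosSemidef.one.smul (abs_nonneg _))
  rw [traceAbs, h2, abs_mul, abs_of_nonneg (Real.sqrt_nonneg _)]
  simp
  ring

/-- The Hermitian matrix with real part `(a, b; b, c)` and imaginary part `k ε`. -/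
def hermMat (a b c k : ℝ) : Matrix (Fin 2) (Fin 2) ℂ :=
  !![(a : ℂ), b + k * Complex.I; b - k * Complex.I, (c : ℂ)]

theorem map_re_hermMat (a b c k : ℝ) : (hermMat a b c k).map Complex.re = !![a, b; b, c] := by
  ext i j
  fin_cases i <;> fin_cases j <;> simp [hermMat]

theorem map_im_hermMat (a b c k : ℝ) : (hermMat a b c k).map Complex.im = !![0, k; -k, 0] := by
  ext i j
  fin_cases i <;> fin_cases j <;> simp [hermMat]

theorem weightedBound_hermMat {G : Matrix (Fin 2) (Fin 2) ℝ} (hG : G.PosDef) (a b c k : ℝ) :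
    weightedBound G (hermMat a b c k)
      = G 0 0 * a + 2 * G 0 1 * b + G 1 1 * c + 2 * √G.det * |k| := by
  rw [weightedBound, map_im_hermMat, traceAbs_antisymm hG]
  simp [hermMat, Matrix.trace_fin_two, Matrix.mul_apply, Fin.sum_univ_two, weight_symm hG]
  ring

/-- The determinant vanishes, so for a > 0 the matrix is a⁻¹ times the rank one projector-like
product of its first column with its adjoint. -/
theorem hermMat_posSemidef {a b c k : ℝ} (ha : 0 ≤ a) (hc : 0 ≤ c) (h : a * c = b ^ 2 + k ^ 2) :
    (hermMat a b c k).PosSemidef := by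
  rcases ha.eq_or_lt with rfl | ha
  · have hb : b = 0 := by nlinarith [sq_nonneg b, sq_nonneg k]
    have hk : k = 0 := by nlinarith [sq_nonneg b, sq_nonneg k]
    subst hb hk
    have h1 : hermMat 0 0 c 0 = Matrix.diagonal ![0, (c : ℂ)] := by
      ext i j
      fin_cases i <;> fin_cases j <;> simp [hermMat]
    rw [h1, Matrix.posSemidef_diagonal_iff]
    intro i
    fin_cases i <;> simp [hc]
  · have h1 : hermMat a b c k = ((a⁻¹ : ℝ) : ℂ)
        • Matrix.vecMulVec ![(a : ℂ), b - k * Complex.I] (star ![(a : ℂ), b - k * Complex.I]) := by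
      have ha' : (a : ℂ) ≠ 0 := by exact_mod_cast ha.ne'
      have h' : (a : ℂ) * c = b ^ 2 + k ^ 2 := by exact_mod_cast h
      ext i j
      fin_cases i <;> fin_cases j <;> simp [hermMat, Matrix.vecMulVec, ha']
      · field_simp
      · rw [eq_inv_mul_iff_mul_eq₀ ha']
        linear_combination h' + (k : ℂ) ^ 2 * Complex.I_sq
    rw [h1]
    refine (Matrix.posSemidef_vecMulVec_self_star _).smul ?_
    exact_mod_cast (inv_pos.2 ha).le

/-- Weak duality between `V ≥ Z` and `Tr |√G (Im Z) √G|`. -/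
theorem le_trace_of_hermMat_le {G : Matrix (Fin 2) (Fin 2) ℝ} (hG : G.PosDef) {a b c k : ℝ}
    {V : Matrix (Fin 2) (Fin 2) ℝ} (hV : (V.map Complex.ofReal - hermMat a b c k).PosSemidef) :
    G 0 0 * a + 2 * G 0 1 * b + G 1 1 * c + 2 * √G.det * |k| ≤ (G * V).trace := by
  have hoff := hV.isHermitian.apply 0 1
  have hsym : V 1 0 = V 0 1 := by
    have := congrArg Complex.re hoff
    simpa [hermMat] using this
  have h0 : 0 ≤ V 0 0 - a := by
    have := hV.diag_nonneg (i := 0)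
    rw [Complex.le_def] at this
    simpa [hermMat] using this.1
  have h1 : 0 ≤ V 1 1 - c := by
    have := hV.diag_nonneg (i := 1)
    rw [Complex.le_def] at this
    simpa [hermMat] using this.1
  have hdet : 0 ≤ (V 0 0 - a) * (V 1 1 - c) - (V 0 1 - b) ^ 2 - k ^ 2 := by
    have := hV.det_nonneg
    rw [Matrix.det_fin_two, Complex.le_def] at this
    have := this.1
    simp [hermMat, hsym] at this
    linarith
  have hG0 : 0 < G 0 0 := hG.diag_pos
  have hG1 : 0 < G 1 1 := hG.diag_pos
  have hd := hG.det_pos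
  have htr : (G * V).trace = G 0 0 * V 0 0 + 2 * G 0 1 * V 0 1 + G 1 1 * V 1 1 := by
    simp [Matrix.trace_fin_two, Matrix.mul_apply, Fin.sum_univ_two, weight_symm hG, hsym]
    ring
  have hs := Real.sq_sqrt hd.le
  generalize hp : V 0 0 - a = p at *
  generalize hq : V 1 1 - c = q at *
  generalize hm : V 0 1 - b = m at *
  have hkey : 2 * √G.det * |k| ≤ G 0 0 * p + 2 * G 0 1 * m + G 1 1 * q := by
    rcases h0.eq_or_lt with rfl | hp0
    · have hm0 : m = 0 := by nlinarith [sq_nonneg m, sq_nonneg k]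
      have hk0 : k = 0 := by nlinarith [sq_nonneg m, sq_nonneg k]
      simp only [hm0, hk0, abs_zero, mul_zero, zero_add]
      positivity
    -- Scaled by G 1 1 * p > 0, the gap is two squares plus a nonnegative multiple of det(V - Z).
    · have e1 : G 1 1 * p * (G 0 0 * p + 2 * G 0 1 * m + G 1 1 * q - 2 * √G.det * |k|)
          = (G 1 1 * m + G 0 1 * p) ^ 2 + G 1 1 ^ 2 * (p * q - m ^ 2 - k ^ 2)
            + (√G.det * p - G 1 1 * |k|) ^ 2 := by
        rw [weight_det hG] at hs ⊢
        linear_combination (-p ^ 2) * hs - G 1 1 ^ 2 * sq_abs k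
      have e2 : 0 ≤ G 0 0 * p + 2 * G 0 1 * m + G 1 1 * q - 2 * √G.det * |k| := by
        refine nonneg_of_mul_nonneg_right ?_ (mul_pos hG1 hp0)
        rw [e1]
        positivity
      linarith
  rw [htr]
  subst hp hq hm
  linarith

/-- Weak duality is saturated by V = Re Z + (|k| / √det G) adj G, for which V - Z is singular and Tr
G adj G = 2 det G. -/
theorem exists_hermMat_le {G : Matrix (Fin 2) (Fin 2) ℝ} (hG : G.PosDef) (a b c k : ℝ) :
    ∃ V : Matrix (Fin 2) (Fin 2) ℝ, (V.map Complex.ofReal - hermMat a b c k).PosSemidef ∧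
      (G * V).trace = G 0 0 * a + 2 * G 0 1 * b + G 1 1 * c + 2 * √G.det * |k| := by
  have hG0 : 0 < G 0 0 := hG.diag_pos
  have hG1 : 0 < G 1 1 := hG.diag_pos
  have hd := hG.det_pos
  have hg : 0 < √G.det := Real.sqrt_pos.2 hd
  have hs : √G.det ^ 2 = G 0 0 * G 1 1 - G 0 1 ^ 2 := by rw [Real.sq_sqrt hd.le, weight_det hG]
  generalize √G.det = g at *
  refine ⟨!![a + |k| / g * G 1 1, b - |k| / g * G 0 1; b - |k| / g * G 0 1, c + |k| / g * G 0 0],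
    ?_, ?_⟩
  · have h1 : (!![a + |k| / g * G 1 1, b - |k| / g * G 0 1; b - |k| / g * G 0 1,
        c + |k| / g * G 0 0].map Complex.ofReal - hermMat a b c k)
        = hermMat (|k| / g * G 1 1) (-(|k| / g * G 0 1)) (|k| / g * G 0 0) (-k) := by
      ext i j
      fin_cases i <;> fin_cases j <;> simp [hermMat] <;> ring
    rw [h1]
    refine hermMat_posSemidef (by positivity) (by positivity) ?_
    field_simp
    have := sq_abs k
    linear_combination (G 1 1 * G 0 0 - G 0 1 ^ 2) * this - k ^ 2 * hs
  · simp [Matrix.trace_fin_two, Matrix.mul_apply, Fin.sum_univ_two, weight_symm hG]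
    field_simp
    linear_combination (-2) * |k| * hs

/-! ### Operators on a two dimensional space as Pauli combinations -/

/-- The Pauli combination `w + x σ₁ + y σ₂ + z σ₃`. -/
noncomputable def pauliMat (w x y z : ℝ) : Matrix (Fin 2) (Fin 2) ℂ :=
  !![((w + z : ℝ) : ℂ), x - y * Complex.I; x + y * Complex.I, ((w - z : ℝ) : ℂ)]

theorem isSelfAdjoint_pauliMat (w x y z : ℝ) : IsSelfAdjoint (pauliMat w x y z) := by
  rw [IsSelfAdjoint, Matrix.star_eq_conjTranspose]
  ext i j
  fin_cases i <;> fin_cases j <;> simp [pauliMat, sub_eq_add_neg]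

theorem exists_eq_pauliMat {A : Matrix (Fin 2) (Fin 2) ℂ} (hA : IsSelfAdjoint A) :
    ∃ w x y z, A = pauliMat w x y z := by
  have h : ∀ i j, star (A j i) = A i j := fun i j => by
    conv_rhs => rw [← hA.star_eq]
    rfl
  have h00 := congrArg Complex.im (h 0 0)
  have h11 := congrArg Complex.im (h 1 1)
  have h10r := congrArg Complex.re (h 1 0)
  have h10i := congrArg Complex.im (h 1 0)
  simp at h00 h11 h10r h10i
  refine ⟨((A 0 0).re + (A 1 1).re) / 2, (A 0 1).re, -(A 0 1).im,
    ((A 0 0).re - (A 1 1).re) / 2, ?_⟩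
  ext i j
  fin_cases i <;> fin_cases j <;> refine Complex.ext ?_ ?_ <;> simp [pauliMat] <;> linarith

theorem exists_eq_pauliMat_of_trace_eq_zero {A : Matrix (Fin 2) (Fin 2) ℂ} (hA : IsSelfAdjoint A)
    (htr : A.trace = 0) : ∃ x y z, A = pauliMat 0 (x / 2) (y / 2) (z / 2) := by
  obtain ⟨w, x, y, z, rfl⟩ := exists_eq_pauliMat hA
  have hw : w = 0 := by
    have := congrArg Complex.re htr
    simp [pauliMat, Matrix.trace_fin_two] at this
    linarith
  refine ⟨2 * x, 2 * y, 2 * z, ?_⟩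
  rw [hw]
  congr 1 <;> ring

/-- A faithful state of a qubit is diagonal in a suitable orthonormal basis. -/
theorem exists_starAlgEquiv_diagonalizing (hdim : Module.finrank ℂ H = 2) {ρ : H →L[ℂ] H}
    (hρ : IsDensityOperator ρ) (hpos : IsStrictlyPositive ρ) :
    ∃ (φ : (H →L[ℂ] H) ≃⋆ₐ[ℂ] Matrix (Fin 2) (Fin 2) ℂ) (r : ℝ),
      r ^ 2 < 1 ∧ (∀ A, opTrace A = (φ A).trace) ∧ φ ρ = pauliMat (1 / 2) 0 0 (r / 2) := by
  have : FiniteDimensional ℂ H := Module.finite_of_finrank_pos (by omega)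
  have hsym : (ρ : H →ₗ[ℂ] H).IsSymmetric := hρ.1.isSymmetric
  let b := hsym.eigenvectorBasis hdim
  let e : (H →ₗ[ℂ] H) ≃⋆ₐ[ℂ] (H →L[ℂ] H) :=
    { LinearMap.toContinuousLinearMap with
      map_mul' := fun _ _ ↦ rfl
      map_star' := LinearMap.adjoint_toContinuousLinearMap }
  let φ := e.symm.trans (LinearMap.toMatrixOrthonormal b)
  have hφ : ∀ A, φ A = LinearMap.toMatrix b.toBasis b.toBasis (A : H →ₗ[ℂ] H) := fun A => rfl
  have htr : ∀ A, opTrace A = (φ A).trace := fun A => by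
    rw [hφ, opTrace, LinearMap.trace_eq_matrix_trace ℂ b.toBasis]
  have hentry : ∀ i j, φ ρ i j = if i = j then (hsym.eigenvalues hdim j : ℂ) else 0 := by
    intro i j
    have h1 : φ ρ i j = inner ℂ (b i) (ρ (b j)) :=
      LinearMap.toMatrixOrthonormal_apply_apply b (ρ : H →ₗ[ℂ] H) i j
    have h2 : ρ (b j) = (hsym.eigenvalues hdim j : ℂ) • b j := hsym.apply_eigenvectorBasis hdim j
    rw [h1, h2, inner_smul_right, orthonormal_iff_ite.1 b.orthonormal]
    simp
  generalize hp : hsym.eigenvalues hdim 0 = p at *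
  generalize hq : hsym.eigenvalues hdim 1 = q at *
  have hmat : φ ρ = !![(p : ℂ), 0; 0, (q : ℂ)] := by
    ext i j
    rw [hentry]
    fin_cases i <;> fin_cases j <;> simp [hp, hq]
  have hnn : ∀ i, 0 ≤ (φ ρ i i).re := by
    intro i
    have h1 : φ ρ i i = inner ℂ (b i) (ρ (b i)) :=
      LinearMap.toMatrixOrthonormal_apply_apply b (ρ : H →ₗ[ℂ] H) i i
    rw [h1]
    exact hρ.1.re_inner_nonneg_right (b i)
  have hp0 : 0 ≤ p := by simpa [hmat] using hnn 0
  have hq0 : 0 ≤ q := by simpa [hmat] using hnn 1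
  have hdet : p * q ≠ 0 := by
    have h1 : IsUnit (φ ρ) := hpos.isUnit.map φ
    have h2 := ((Matrix.isUnit_iff_isUnit_det _).1 h1).ne_zero
    rw [hmat, Matrix.det_fin_two] at h2
    simp at h2
    simp [h2]
  have hsum : p + q = 1 := by
    have h1 := htr ρ
    rw [hρ.2, hmat, Matrix.trace_fin_two] at h1
    have := congrArg Complex.re h1
    simp at this
    linarith
  -- With p + q = 1 and r = p - q, this is 1 - r² = 4pq > 0.
  have hpq : 0 < p * q := lt_of_le_of_ne (mul_nonneg hp0 hq0) hdet.symm
  refine ⟨φ, p - q, by nlinarith, htr, ?_⟩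
  rw [hmat]
  ext i j
  fin_cases i <;> fin_cases j <;> refine Complex.ext ?_ ?_ <;> simp [pauliMat] <;> linarith

/-! ### Derivatives of a family of states -/

theorem QuantumModel.hasDerivAt_pderiv {d : ℕ} (M : QuantumModel d H) {θ : Fin d → ℝ}
    (hθ : θ ∈ M.params) (i : Fin d) :
    HasDerivAt (fun t : ℝ => M.state (θ + t • Pi.single i 1)) (M.pderiv θ i) 0 := by
  have h : DifferentiableAt ℝ M.state θ :=
    (M.smooth.contDiffAt (M.isOpen_params.mem_nhds hθ)).differentiableAt (by simp)
  exact h.lineDifferentiableAt.hasLineDerivAt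

theorem QuantumModel.eventually_isDensityOperator {d : ℕ} (M : QuantumModel d H) {θ : Fin d → ℝ}
    (hθ : θ ∈ M.params) (i : Fin d) :
    ∀ᶠ t : ℝ in nhds 0, IsDensityOperator (M.state (θ + t • Pi.single i 1)) := by
  have hc : Continuous fun t : ℝ => θ + t • (Pi.single i 1 : Fin d → ℝ) := by fun_prop
  have := hc.continuousAt.eventually_mem (x := 0) (s := M.params)
    (M.isOpen_params.mem_nhds (by simpa using hθ))
  exact this.mono fun t ht => M.isDensity _ ht

/-- The curve and its adjoint agree near 0, so their derivatives agree; the trace is treated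
likewise below. -/
theorem QuantumModel.isSelfAdjoint_pderiv {d : ℕ} (M : QuantumModel d H) {θ : Fin d → ℝ}
    (hθ : θ ∈ M.params) (i : Fin d) : IsSelfAdjoint (M.pderiv θ i) := by
  have h := M.hasDerivAt_pderiv hθ i
  refine h.star.unique (h.congr_of_eventuallyEq ?_)
  filter_upwards [M.eventually_isDensityOperator hθ i] with t ht
  exact ht.1.isSelfAdjoint.star_eq

theorem QuantumModel.opTrace_pderiv [FiniteDimensional ℂ H] {d : ℕ} (M : QuantumModel d H)
    {θ : Fin d → ℝ} (hθ : θ ∈ M.params) (i : Fin d) : opTrace (M.pderiv θ i) = 0 := by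
  have h := M.hasDerivAt_pderiv hθ i
  let T : (H →L[ℂ] H) →ₗ[ℝ] ℂ :=
    { toFun := opTrace
      map_add' := fun A B => by simp [opTrace]
      map_smul' := fun c A => by
        have : ((c • A : H →L[ℂ] H) : H →ₗ[ℂ] H) = (c : ℂ) • (A : H →ₗ[ℂ] H) := by
          ext x; simp
        simp [opTrace, this] }
  have hT := (LinearMap.toContinuousLinearMap T).hasFDerivAt.comp_hasDerivAt 0 h
  refine hT.unique ((hasDerivAt_const (0 : ℝ) (1 : ℂ)).congr_of_eventuallyEq ?_)
  filter_upwards [M.eventually_isDensityOperator hθ i] with t ht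
  exact ht.2

/-! ### Pauli arithmetic and Hermitian inverses -/

theorem smul_pauliMat (c w x y z : ℝ) :
    (c : ℂ) • pauliMat w x y z = pauliMat (c * w) (c * x) (c * y) (c * z) := by
  ext i j
  fin_cases i <;> fin_cases j <;> simp [pauliMat] <;> ring

theorem pauliMat_add (w x y z w' x' y' z' : ℝ) :
    pauliMat w x y z + pauliMat w' x' y' z' = pauliMat (w + w') (x + x') (y + y') (z + z') := by
  ext i j
  fin_cases i <;> fin_cases j <;> simp [pauliMat] <;> ring

theorem pauliMat_eq_zero : pauliMat 0 0 0 0 = 0 := by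
  ext i j
  fin_cases i <;> fin_cases j <;> simp [pauliMat]

theorem trace_pauliMat_mul (w x y z w' x' y' z' : ℝ) :
    (pauliMat w x y z * pauliMat w' x' y' z').trace
      = ((2 * (w * w' + x * x' + y * y' + z * z') : ℝ) : ℂ) := by
  simp [pauliMat, Matrix.trace_fin_two]
  linear_combination (-2 * (y : ℂ) * y') * Complex.I_sq

/-- `Tr ρ B C` for `ρ = (1 + r σ₃) / 2`. -/
theorem trace_state_mul_pauliMat (r w x y z w' x' y' z' : ℝ) :
    (pauliMat (1 / 2) 0 0 (r / 2) * pauliMat w x y z * pauliMat w' x' y' z').trace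
      = ((w * w' + x * x' + y * y' + z * z' + r * (w * z' + z * w') : ℝ) : ℂ)
        + ((r * (x * y' - y * x') : ℝ) : ℂ) * Complex.I := by
  simp [pauliMat, Matrix.trace_fin_two]
  linear_combination (-(y : ℂ) * y') * Complex.I_sq

theorem inv_hermMat {a b c k D : ℝ} (hD : D ≠ 0) (h : a * c - b ^ 2 - k ^ 2 = D) :
    (hermMat a b c k)⁻¹ = hermMat (c / D) (-b / D) (a / D) (-k / D) := by
  refine Matrix.inv_eq_right_inv ?_
  have hD' : (D : ℂ) ≠ 0 := by exact_mod_cast hD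
  have h' : (a : ℂ) * c - b ^ 2 - k ^ 2 = D := by exact_mod_cast h
  ext i j
  fin_cases i <;> fin_cases j <;> simp [hermMat] <;> field_simp
  · linear_combination h' + (k : ℂ) ^ 2 * Complex.I_sq
  · ring
  · ring
  · linear_combination h' + (k : ℂ) ^ 2 * Complex.I_sq

/-- L* ρ = (ρ L)* = ∂ρ because ∂ρ is self-adjoint. This makes C^(R) the endpoint β = 1 of the
family. -/
theorem QuantumModel.fisherR_eq_fisherBeta_one [FiniteDimensional ℂ H] {d : ℕ}
    (M : QuantumModel d H) {θ : Fin d → ℝ} (hθ : θ ∈ M.params)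
    (hpos : IsStrictlyPositive (M.state θ)) : M.fisherR θ = M.fisherBeta θ 1 := by
  ext i j
  have h := (M.pderiv_eq_iff_eq_logDeriv hpos (β := 1) (by norm_num) i (M.rld θ i)).2 rfl
  have h' : M.pderiv θ i = M.state θ * M.rld θ i := by simpa using h
  have hρ : IsSelfAdjoint (M.state θ) := (M.isDensity θ hθ).1.isSelfAdjoint
  have h2 : star (M.rld θ i) * M.state θ = M.pderiv θ i := by
    rw [← (M.isSelfAdjoint_pderiv hθ i).star_eq, h', star_mul, hρ.star_eq]
  rw [QuantumModel.fisherR, QuantumModel.fisherBeta, Matrix.of_apply, Matrix.of_apply, h2]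
  rfl

/-- Bloch coordinates of a faithful qubit model at a point, in an eigenbasis of the state:
`ρ = (1 + r σ₃) / 2` and `∂_i ρ = (x_i σ₁ + y_i σ₂ + z_i σ₃) / 2`. -/
structure BlochCoords (M : QuantumModel 2 H) (θ : Fin 2 → ℝ) where
  /-- the operators as matrices -/
  φ : (H →L[ℂ] H) ≃⋆ₐ[ℂ] Matrix (Fin 2) (Fin 2) ℂ
  /-- the Bloch radius of the state -/
  r : ℝ
  /-- the first coordinates of the derivatives -/
  x : Fin 2 → ℝ
  /-- the second coordinates of the derivatives -/
  y : Fin 2 → ℝ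
  /-- the third coordinates of the derivatives -/
  z : Fin 2 → ℝ
  r_sq_lt : r ^ 2 < 1
  opTrace_eq : ∀ A, opTrace A = (φ A).trace
  state_eq : φ (M.state θ) = pauliMat (1 / 2) 0 0 (r / 2)
  pderiv_eq : ∀ i, φ (M.pderiv θ i) = pauliMat 0 (x i / 2) (y i / 2) (z i / 2)

theorem nonempty_blochCoords (hdim : Module.finrank ℂ H = 2) (M : QuantumModel 2 H)
    {θ : Fin 2 → ℝ} (hθ : θ ∈ M.params) (hpos : IsStrictlyPositive (M.state θ)) :
    Nonempty (BlochCoords M θ) := by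
  have : FiniteDimensional ℂ H := Module.finite_of_finrank_pos (by omega)
  obtain ⟨φ, r, hr, htr, hρ⟩ := exists_starAlgEquiv_diagonalizing hdim (M.isDensity θ hθ) hpos
  have h : ∀ i, ∃ x y z, φ (M.pderiv θ i) = pauliMat 0 (x / 2) (y / 2) (z / 2) := fun i =>
    exists_eq_pauliMat_of_trace_eq_zero ((M.isSelfAdjoint_pderiv hθ i).map φ)
      (by rw [← htr, M.opTrace_pderiv hθ])
  choose x y z hxyz using h
  exact ⟨⟨φ, r, x, y, z, hr, htr, hρ, hxyz⟩⟩

namespace BlochCoords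

variable {M : QuantumModel 2 H} {θ : Fin 2 → ℝ} (c : BlochCoords M θ)

/-- The first coordinate of the normal to the tangent plane. -/
def n₁ : ℝ := c.y 0 * c.z 1 - c.z 0 * c.y 1
/-- The second coordinate of the normal to the tangent plane. -/
def n₂ : ℝ := c.z 0 * c.x 1 - c.x 0 * c.z 1
/-- The third coordinate of the normal to the tangent plane. -/
def n₃ : ℝ := c.x 0 * c.y 1 - c.y 0 * c.x 1

/-- The squared length of the normal for the metric `diag(1, 1, 1 - r²)`. -/
def K : ℝ := c.n₁ ^ 2 + c.n₂ ^ 2 + (1 - c.r ^ 2) * c.n₃ ^ 2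

/-- The inverse SLD Fisher information matrix. -/
noncomputable def A : Matrix (Fin 2) (Fin 2) ℝ :=
  !![((1 - c.r ^ 2) * (c.x 1 ^ 2 + c.y 1 ^ 2) + c.z 1 ^ 2) / c.K,
     -((1 - c.r ^ 2) * (c.x 0 * c.x 1 + c.y 0 * c.y 1) + c.z 0 * c.z 1) / c.K;
     -((1 - c.r ^ 2) * (c.x 0 * c.x 1 + c.y 0 * c.y 1) + c.z 0 * c.z 1) / c.K,
     ((1 - c.r ^ 2) * (c.x 0 ^ 2 + c.y 0 ^ 2) + c.z 0 ^ 2) / c.K]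

theorem one_sub_r_sq_pos : 0 < 1 - c.r ^ 2 := by linarith [c.r_sq_lt]

theorem K_pos (hreg : LinearIndependent ℝ (M.pderiv θ)) : 0 < c.K := by
  by_contra hK
  have hr := c.one_sub_r_sq_pos
  have e1 : c.n₁ ^ 2 = 0 := by
    have : 0 ≤ (1 - c.r ^ 2) * c.n₃ ^ 2 := by positivity
    unfold K at hK
    nlinarith [sq_nonneg c.n₁, sq_nonneg c.n₂]
  have e2 : c.n₂ ^ 2 = 0 := by
    have : 0 ≤ (1 - c.r ^ 2) * c.n₃ ^ 2 := by positivity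
    unfold K at hK
    nlinarith [sq_nonneg c.n₁, sq_nonneg c.n₂]
  have e3 : (1 - c.r ^ 2) * c.n₃ ^ 2 = 0 := by
    have : 0 ≤ (1 - c.r ^ 2) * c.n₃ ^ 2 := by positivity
    unfold K at hK
    nlinarith [sq_nonneg c.n₁, sq_nonneg c.n₂]
  have h1 : c.n₁ = 0 := by simpa using e1
  have h2 : c.n₂ = 0 := by simpa using e2
  have h3 : c.n₃ = 0 := by simpa [hr.ne'] using e3
  unfold n₁ at h1
  unfold n₂ at h2
  unfold n₃ at h3
  have key : ∀ s t : ℝ, s * c.x 0 + t * c.x 1 = 0 → s * c.y 0 + t * c.y 1 = 0 →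
      s * c.z 0 + t * c.z 1 = 0 → s = 0 ∧ t = 0 := by
    intro s t hx hy hz
    have hli := LinearIndependent.pair_iff.1
      (show LinearIndependent ℝ ![M.pderiv θ 0, M.pderiv θ 1] by
        convert hreg using 1
        ext i : 1
        fin_cases i <;> rfl)
    refine hli s t (EquivLike.injective c.φ ?_)
    rw [← Complex.coe_smul s, ← Complex.coe_smul t, map_add, map_smul, map_smul, c.pderiv_eq,
      c.pderiv_eq, smul_pauliMat, smul_pauliMat, pauliMat_add, map_zero, ← pauliMat_eq_zero]
    congr 1 <;> linarith
  -- A vanishing cross product gives x_1 u_0 = x_0 u_1, and the same with y and z. Independence then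
  -- forces u_0 = 0, a contradiction.
  have hx := key (c.x 1) (-c.x 0) (by ring) (by linarith) (by linarith)
  have hy := key (c.y 1) (-c.y 0) (by linarith) (by ring) (by linarith)
  have hz := key (c.z 1) (-c.z 0) (by linarith) (by linarith) (by ring)
  exact one_ne_zero (key 1 0 (by linarith [hx.2]) (by linarith [hy.2]) (by linarith [hz.2])).1

/-! ### Logarithmic derivatives and information matrices -/

/-- In the eigenbasis the superoperator acts entrywise, with factors (1 ± r)/2 on the diagonal and
(1 ± βr)/2 off it. -/
theorem logDeriv_eq [FiniteDimensional ℂ H] (hpos : IsStrictlyPositive (M.state θ)) {β : ℝ}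
    (hβ : β ∈ Icc (0 : ℝ) 1) (i : Fin 2) :
    c.φ (M.logDeriv θ β i)
      = !![((c.z i / (1 + c.r) : ℝ) : ℂ), (c.x i - c.y i * Complex.I) / ((1 + β * c.r : ℝ) : ℂ);
           (c.x i + c.y i * Complex.I) / ((1 - β * c.r : ℝ) : ℂ),
           ((-c.z i / (1 - c.r) : ℝ) : ℂ)] := by
  have hr : -1 < c.r ∧ c.r < 1 := abs_lt.1 ((sq_lt_one_iff_abs_lt_one _).1 c.r_sq_lt)
  have hs : -1 < β * c.r ∧ β * c.r < 1 := by
    constructor <;> nlinarith [hβ.1, hβ.2, hr.1, hr.2]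
  have h1 : ((1 + c.r : ℝ) : ℂ) ≠ 0 := by exact_mod_cast (by linarith : 1 + c.r ≠ 0)
  have h2 : ((1 - c.r : ℝ) : ℂ) ≠ 0 := by exact_mod_cast (by linarith : 1 - c.r ≠ 0)
  have h3 : ((1 + β * c.r : ℝ) : ℂ) ≠ 0 := by exact_mod_cast (by linarith : 1 + β * c.r ≠ 0)
  have h4 : ((1 - β * c.r : ℝ) : ℂ) ≠ 0 := by exact_mod_cast (by linarith : 1 - β * c.r ≠ 0)
  set W : Matrix (Fin 2) (Fin 2) ℂ :=
    !![((c.z i / (1 + c.r) : ℝ) : ℂ), (c.x i - c.y i * Complex.I) / ((1 + β * c.r : ℝ) : ℂ);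
       (c.x i + c.y i * Complex.I) / ((1 - β * c.r : ℝ) : ℂ), ((-c.z i / (1 - c.r) : ℝ) : ℂ)]
    with hW
  have h : c.φ.symm W = M.logDeriv θ β i := by
    refine (M.pderiv_eq_iff_eq_logDeriv hpos ⟨by linarith [hβ.1], hβ.2⟩ i _).1
      (EquivLike.injective c.φ ?_)
    rw [map_add, map_smul, map_smul, map_mul, map_mul, c.pderiv_eq, c.state_eq,
      StarAlgEquiv.apply_symm_apply]
    push_cast at h1 h2 h3 h4
    ext k l
    fin_cases k <;> fin_cases l <;> simp [hW, pauliMat] <;> field_simp <;> ring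
  rw [← h, StarAlgEquiv.apply_symm_apply]

theorem fisherBeta_eq [FiniteDimensional ℂ H] (hpos : IsStrictlyPositive (M.state θ)) {β : ℝ}
    (hβ : β ∈ Icc (0 : ℝ) 1) :
    M.fisherBeta θ β = hermMat
      (c.z 0 ^ 2 / (1 - c.r ^ 2) + (c.x 0 ^ 2 + c.y 0 ^ 2) / (1 - (β * c.r) ^ 2))
      (c.z 0 * c.z 1 / (1 - c.r ^ 2) + (c.x 0 * c.x 1 + c.y 0 * c.y 1) / (1 - (β * c.r) ^ 2))
      (c.z 1 ^ 2 / (1 - c.r ^ 2) + (c.x 1 ^ 2 + c.y 1 ^ 2) / (1 - (β * c.r) ^ 2))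
      (β * c.r * c.n₃ / (1 - (β * c.r) ^ 2)) := by
  have hr : -1 < c.r ∧ c.r < 1 := abs_lt.1 ((sq_lt_one_iff_abs_lt_one _).1 c.r_sq_lt)
  have hs : -1 < β * c.r ∧ β * c.r < 1 := by
    constructor <;> nlinarith [hβ.1, hβ.2, hr.1, hr.2]
  have h1 : (1 + c.r : ℂ) ≠ 0 := by exact_mod_cast (by linarith : 1 + c.r ≠ 0)
  have h2 : (1 - c.r : ℂ) ≠ 0 := by exact_mod_cast (by linarith : 1 - c.r ≠ 0)
  ext i j
  rw [QuantumModel.fisherBeta, Matrix.of_apply, c.opTrace_eq, map_mul, c.logDeriv_eq hpos hβ,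
    c.pderiv_eq]
  generalize β * c.r = s at *
  have h3 : (1 + s : ℂ) ≠ 0 := by exact_mod_cast (by linarith : 1 + s ≠ 0)
  have h4 : (1 - s : ℂ) ≠ 0 := by exact_mod_cast (by linarith : 1 - s ≠ 0)
  have h5 : (1 - c.r ^ 2 : ℂ) = (1 + c.r) * (1 - c.r) := by ring
  have h6 : (1 - s ^ 2 : ℂ) = (1 + s) * (1 - s) := by ring
  fin_cases i <;> fin_cases j <;> simp [pauliMat, hermMat, Matrix.trace_fin_two, n₃] <;>
    rw [h5, h6] <;> field_simp <;> ring_nf <;> simp only [Complex.I_sq] <;> ring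

/-- The determinant is K / ((1 - r²)(1 - β²r²)), so inversion cancels the β-dependent denominators:
the real part is quadratic in β and the imaginary part linear. -/
theorem inv_fisherBeta_eq [FiniteDimensional ℂ H] (hpos : IsStrictlyPositive (M.state θ))
    (hK : 0 < c.K) {β : ℝ} (hβ : β ∈ Icc (0 : ℝ) 1) :
    (M.fisherBeta θ β)⁻¹ = hermMat
      (c.A 0 0 - β ^ 2 * (c.r ^ 2 * c.z 1 ^ 2 / c.K))
      (c.A 0 1 + β ^ 2 * (c.r ^ 2 * (c.z 0 * c.z 1) / c.K))
      (c.A 1 1 - β ^ 2 * (c.r ^ 2 * c.z 0 ^ 2 / c.K))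
      (-(β * (c.r * ((1 - c.r ^ 2) * c.n₃ / c.K)))) := by
  have hr := c.one_sub_r_sq_pos
  have hs : 0 < 1 - β ^ 2 * c.r ^ 2 := by
    nlinarith [mul_nonneg (by nlinarith [hβ.1, hβ.2] : 0 ≤ 1 - β ^ 2) (sq_nonneg c.r)]
  have hD : c.K / ((1 - c.r ^ 2) * (1 - β ^ 2 * c.r ^ 2)) ≠ 0 := by positivity
  rw [c.fisherBeta_eq hpos hβ, mul_pow]
  generalize he : 1 - β ^ 2 * c.r ^ 2 = e at *
  rw [inv_hermMat hD]
  · simp only [A, Matrix.of_apply, Matrix.cons_val]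
    congr 1 <;> field_simp <;> rw [← he] <;> ring
  · simp only [K, n₁, n₂, n₃]
    field_simp
    rw [← he]
    ring

/-- The scalar part is -r times the third coordinate, which is the condition Tr ρ L = 0. -/
theorem sld_eq [FiniteDimensional ℂ H] (hpos : IsStrictlyPositive (M.state θ)) (i : Fin 2) :
    c.φ (M.sld θ i) = pauliMat (-c.r * (c.z i / (1 - c.r ^ 2))) (c.x i) (c.y i)
      (c.z i / (1 - c.r ^ 2)) := by
  have hr : -1 < c.r ∧ c.r < 1 := abs_lt.1 ((sq_lt_one_iff_abs_lt_one _).1 c.r_sq_lt)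
  have h1 : (1 + c.r : ℂ) ≠ 0 := by exact_mod_cast (by linarith : 1 + c.r ≠ 0)
  have h2 : (1 - c.r : ℂ) ≠ 0 := by exact_mod_cast (by linarith : 1 - c.r ≠ 0)
  have h5 : (1 - c.r ^ 2 : ℂ) = (1 + c.r) * (1 - c.r) := by ring
  rw [QuantumModel.sld, c.logDeriv_eq hpos ⟨le_rfl, zero_le_one⟩]
  ext k l
  fin_cases k <;> fin_cases l <;> simp [pauliMat]
  · rw [h5]; field_simp; ring
  · rw [h5]; field_simp; ring

theorem inv_fisherS_eq [FiniteDimensional ℂ H] (hpos : IsStrictlyPositive (M.state θ))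
    (hK : 0 < c.K) : (M.fisherS θ)⁻¹ = c.A := by
  have hr := c.one_sub_r_sq_pos
  have h : M.fisherS θ = Matrix.of fun i j =>
      c.x i * c.x j + c.y i * c.y j + c.z i * c.z j / (1 - c.r ^ 2) := by
    ext i j
    rw [QuantumModel.fisherS, Matrix.of_apply, c.opTrace_eq, map_mul, map_mul, c.sld_eq hpos,
      c.sld_eq hpos, c.state_eq, trace_state_mul_pauliMat]
    simp only [Complex.add_re, Complex.ofReal_re, Complex.re_ofReal_mul, Complex.I_re,
      Matrix.of_apply]
    field_simp
    ring
  refine Matrix.inv_eq_right_inv ?_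
  rw [h]
  ext i j
  fin_cases i <;> fin_cases j <;> simp [Matrix.mul_apply, Fin.sum_univ_two, A] <;> field_simp <;>
    simp only [K, n₁, n₂, n₃] <;> ring

end BlochCoords

/-- A vector orthogonal to `u` and `v` is a multiple of `u × v`. -/
theorem exists_eq_mul_cross {u₁ u₂ u₃ v₁ v₂ v₃ d₁ d₂ d₃ : ℝ}
    (h : 0 < (u₂ * v₃ - u₃ * v₂) ^ 2 + (u₃ * v₁ - u₁ * v₃) ^ 2 + (u₁ * v₂ - u₂ * v₁) ^ 2)
    (hu : u₁ * d₁ + u₂ * d₂ + u₃ * d₃ = 0) (hv : v₁ * d₁ + v₂ * d₂ + v₃ * d₃ = 0) :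
    ∃ t, d₁ = t * (u₂ * v₃ - u₃ * v₂) ∧ d₂ = t * (u₃ * v₁ - u₁ * v₃) ∧
      d₃ = t * (u₁ * v₂ - u₂ * v₁) := by
  generalize h1 : u₂ * v₃ - u₃ * v₂ = m₁ at *
  generalize h2 : u₃ * v₁ - u₁ * v₃ = m₂ at *
  generalize h3 : u₁ * v₂ - u₂ * v₁ = m₃ at *
  -- The projection coefficient of d on m = u × v. The remainder vanishes since |m|² d - (m·d) m =
  -- (m × d) × m and m × d = (u·d) v - (v·d) u.
  refine ⟨(m₁ * d₁ + m₂ * d₂ + m₃ * d₃) / (m₁ ^ 2 + m₂ ^ 2 + m₃ ^ 2), ?_, ?_, ?_⟩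
  · rw [div_mul_eq_mul_div, eq_div_iff h.ne']
    subst h1 h2 h3
    linear_combination (-((u₃ * v₁ - u₁ * v₃) * v₃ - (u₁ * v₂ - u₂ * v₁) * v₂)) * hu
      + ((u₃ * v₁ - u₁ * v₃) * u₃ - (u₁ * v₂ - u₂ * v₁) * u₂) * hv
  · rw [div_mul_eq_mul_div, eq_div_iff h.ne']
    subst h1 h2 h3
    linear_combination (-((u₁ * v₂ - u₂ * v₁) * v₁ - (u₂ * v₃ - u₃ * v₂) * v₃)) * hu
      + ((u₁ * v₂ - u₂ * v₁) * u₁ - (u₂ * v₃ - u₃ * v₂) * u₃) * hv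
  · rw [div_mul_eq_mul_div, eq_div_iff h.ne']
    subst h1 h2 h3
    linear_combination (-((u₂ * v₃ - u₃ * v₂) * v₂ - (u₃ * v₁ - u₁ * v₃) * v₁)) * hu
      + ((u₂ * v₃ - u₃ * v₂) * u₂ - (u₃ * v₁ - u₁ * v₃) * u₁) * hv

namespace BlochCoords

variable {M : QuantumModel 2 H} {θ : Fin 2 → ℝ} (c : BlochCoords M θ)

/-! ### Locally unbiased observables -/

theorem Z_eq {B : Fin 2 → (H →L[ℂ] H)} {w p q s : Fin 2 → ℝ}
    (hB : ∀ j, c.φ (B j) = pauliMat (w j) (p j) (q j) (s j)) :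
    M.Z θ B = hermMat
      (w 0 * w 0 + p 0 * p 0 + q 0 * q 0 + s 0 * s 0 + c.r * (w 0 * s 0 + s 0 * w 0))
      (w 0 * w 1 + p 0 * p 1 + q 0 * q 1 + s 0 * s 1 + c.r * (w 0 * s 1 + s 0 * w 1))
      (w 1 * w 1 + p 1 * p 1 + q 1 * q 1 + s 1 * s 1 + c.r * (w 1 * s 1 + s 1 * w 1))
      (-(c.r * (p 0 * q 1 - q 0 * p 1))) := by
  ext i j
  rw [QuantumModel.Z, Matrix.of_apply, c.opTrace_eq, map_mul, map_mul, c.state_eq, hB, hB,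
    trace_state_mul_pauliMat]
  fin_cases i <;> fin_cases j <;> simp [hermMat] <;> first | ring1 | (right; ring)

theorem opTrace_pderiv_mul {B : H →L[ℂ] H} {w p q s : ℝ} (hB : c.φ B = pauliMat w p q s)
    (i : Fin 2) :
    opTrace (M.pderiv θ i * B) = ((c.x i * p + c.y i * q + c.z i * s : ℝ) : ℂ) := by
  rw [c.opTrace_eq, map_mul, c.pderiv_eq, hB, trace_pauliMat_mul]
  congr 1
  ring

/-- The first coordinates of the locally unbiased observables with normal components `v`. -/
noncomputable def b₁ (v : Fin 2 → ℝ) (j : Fin 2) : ℝ :=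
  c.A j 0 * c.x 0 + c.A j 1 * c.x 1 + v j * c.n₁
/-- The second coordinates of the locally unbiased observables with normal components `v`. -/
noncomputable def b₂ (v : Fin 2 → ℝ) (j : Fin 2) : ℝ :=
  c.A j 0 * c.y 0 + c.A j 1 * c.y 1 + v j * c.n₂
/-- The third coordinates of the locally unbiased observables with normal components `v`. -/
noncomputable def b₃ (v : Fin 2 → ℝ) (j : Fin 2) : ℝ :=
  (c.A j 0 * c.z 0 + c.A j 1 * c.z 1) / (1 - c.r ^ 2) + v j * c.n₃

theorem pairing_b (hK : 0 < c.K) (v : Fin 2 → ℝ) (i j : Fin 2) :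
    c.x i * c.b₁ v j + c.y i * c.b₂ v j + c.z i * c.b₃ v j = if i = j then 1 else 0 := by
  have hr := c.one_sub_r_sq_pos
  have hK' := hK.ne'
  fin_cases i <;> fin_cases j <;> simp [b₁, b₂, b₃, A] <;> field_simp <;>
    simp only [K, n₁, n₂, n₃] <;> ring

/-- The left side is the real part of Tr ρ B_j B_i for centred observables. The dual SLD vectors are
orthogonal to n in the metric diag(1, 1, 1 - r²), so no term linear in v survives. -/
theorem metric_b (hK : 0 < c.K) (v : Fin 2 → ℝ) (i j : Fin 2) :
    c.b₁ v i * c.b₁ v j + c.b₂ v i * c.b₂ v j + (1 - c.r ^ 2) * (c.b₃ v i * c.b₃ v j)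
      = c.A i j + c.K * (v i * v j) := by
  have hr := c.one_sub_r_sq_pos
  have h0 := c.pairing_b hK v 0 j
  have h1 := c.pairing_b hK v 1 j
  have hn : c.b₁ v j * c.n₁ + c.b₂ v j * c.n₂ + (1 - c.r ^ 2) * (c.b₃ v j * c.n₃) = c.K * v j := by
    simp only [b₁, b₂, b₃, K]
    field_simp
    simp only [n₁, n₂, n₃]
    ring
  have h3 : (1 - c.r ^ 2) * (c.b₃ v i * c.b₃ v j)
      = (c.A i 0 * c.z 0 + c.A i 1 * c.z 1) * c.b₃ v j
        + (1 - c.r ^ 2) * (v i * c.n₃ * c.b₃ v j) := by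
    conv_lhs => rw [b₃]
    field_simp
  have h4 : c.A i 0 * (if (0 : Fin 2) = j then 1 else 0)
      + c.A i 1 * (if (1 : Fin 2) = j then 1 else 0) = c.A i j := by
    fin_cases j <;> simp
  rw [h3, ← h4, ← h0, ← h1]
  conv_lhs => enter [1, 1, 1]; rw [b₁]
  conv_lhs => enter [1, 2, 1]; rw [b₂]
  linear_combination v i * hn

/-- This cross product carries Im Z. It is affine in v because the two normal contributions are
parallel. -/
theorem cross_b (hK : 0 < c.K) (v : Fin 2 → ℝ) :
    c.b₁ v 0 * c.b₂ v 1 - c.b₂ v 0 * c.b₁ v 1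
      = (1 - c.r ^ 2) * c.n₃ / c.K - (v 0 * c.z 0 + v 1 * c.z 1) := by
  have hr := c.one_sub_r_sq_pos
  have hdet : c.A 0 0 * c.A 1 1 - c.A 0 1 * c.A 1 0 = (1 - c.r ^ 2) / c.K := by
    simp only [A, Matrix.of_apply, Matrix.cons_val]
    field_simp
    simp only [K, n₁, n₂, n₃]
    ring
  have h : ∀ j, c.n₁ * (c.A j 0 * c.y 0 + c.A j 1 * c.y 1)
      - c.n₂ * (c.A j 0 * c.x 0 + c.A j 1 * c.x 1)
      = if j = 0 then c.z 1 else -c.z 0 := by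
    intro j
    fin_cases j <;> simp [A] <;> field_simp <;> simp only [K, n₁, n₂, n₃] <;> ring
  have h0 := h 0
  have h1 := h 1
  simp at h0 h1
  simp only [b₁, b₂]
  rw [mul_div_right_comm, ← hdet]
  have e3 : c.n₃ = c.x 0 * c.y 1 - c.y 0 * c.x 1 := rfl
  rw [e3]
  linear_combination v 0 * h1 - v 1 * h0

/-- The difference from the solution with v = 0 is orthogonal to both tangent vectors. -/
theorem exists_eq_b (hK : 0 < c.K) {p q s : Fin 2 → ℝ}
    (h : ∀ i j, c.x i * p j + c.y i * q j + c.z i * s j = if i = j then 1 else 0) :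
    ∃ v, ∀ j, p j = c.b₁ v j ∧ q j = c.b₂ v j ∧ s j = c.b₃ v j := by
  have hn : 0 < c.n₁ ^ 2 + c.n₂ ^ 2 + c.n₃ ^ 2 := by
    have : c.K ≤ c.n₁ ^ 2 + c.n₂ ^ 2 + c.n₃ ^ 2 := by
      unfold K
      nlinarith [mul_nonneg (sq_nonneg c.r) (sq_nonneg c.n₃)]
    linarith
  have h1 : ∀ j, ∃ t, p j - c.b₁ 0 j = t * c.n₁ ∧ q j - c.b₂ 0 j = t * c.n₂ ∧
      s j - c.b₃ 0 j = t * c.n₃ := fun j =>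
    exists_eq_mul_cross hn
      (by linear_combination h 0 j - c.pairing_b hK 0 0 j)
      (by linear_combination h 1 j - c.pairing_b hK 0 1 j)
  choose v hv using h1
  refine ⟨v, fun j => ?_⟩
  obtain ⟨e1, e2, e3⟩ := hv j
  simp only [b₁, b₂, b₃, Pi.zero_apply] at e1 e2 e3 ⊢
  exact ⟨by linarith, by linarith, by linarith⟩

/-! ### The bounds in coordinates -/

/-- The SLD bound. -/
noncomputable def cS (G : Matrix (Fin 2) (Fin 2) ℝ) : ℝ :=
  G 0 0 * c.A 0 0 + 2 * G 0 1 * c.A 0 1 + G 1 1 * c.A 1 1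

/-- The noncommutativity term `Tr |√G (Im J_R⁻¹) √G|`. -/
noncomputable def imTerm (G : Matrix (Fin 2) (Fin 2) ℝ) : ℝ :=
  2 * √G.det * |c.r * ((1 - c.r ^ 2) * c.n₃ / c.K)|

/-- The quadratic form `z ↦ zᵀ (adj G) z` at the third coordinates of the derivatives. -/
def adjForm (G : Matrix (Fin 2) (Fin 2) ℝ) : ℝ :=
  G 1 1 * c.z 0 ^ 2 - 2 * G 0 1 * c.z 0 * c.z 1 + G 0 0 * c.z 1 ^ 2

/-- The term `Tr G (J_S⁻¹ - Re J_R⁻¹)`. -/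
noncomputable def reTerm (G : Matrix (Fin 2) (Fin 2) ℝ) : ℝ := c.r ^ 2 * c.adjForm G / c.K

/-- The value of the Holevo problem at the observables with normal components `v`. -/
noncomputable def objective (G : Matrix (Fin 2) (Fin 2) ℝ) (v : Fin 2 → ℝ) : ℝ :=
  c.cS G + c.K * (G 0 0 * v 0 ^ 2 + 2 * G 0 1 * v 0 * v 1 + G 1 1 * v 1 ^ 2)
    + 2 * √G.det * |c.r * ((1 - c.r ^ 2) * c.n₃ / c.K - (v 0 * c.z 0 + v 1 * c.z 1))|

theorem Cbeta_eq [FiniteDimensional ℂ H] (hpos : IsStrictlyPositive (M.state θ))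
    (hK : 0 < c.K) {G : Matrix (Fin 2) (Fin 2) ℝ} (hG : G.PosDef) {β : ℝ}
    (hβ : β ∈ Icc (0 : ℝ) 1) :
    M.Cbeta θ G β = c.cS G + β * c.imTerm G - β ^ 2 * c.reTerm G := by
  rw [QuantumModel.Cbeta, c.inv_fisherBeta_eq hpos hK hβ, weightedBound_hermMat hG, abs_neg,
    abs_mul, abs_of_nonneg hβ.1, cS, imTerm, reTerm, adjForm]
  ring

theorem CS_eq [FiniteDimensional ℂ H] (hpos : IsStrictlyPositive (M.state θ)) (hK : 0 < c.K)
    {G : Matrix (Fin 2) (Fin 2) ℝ} (hG : G.PosDef) : M.CS θ G = c.cS G := by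
  have h : c.A 1 0 = c.A 0 1 := rfl
  rw [QuantumModel.CS, c.inv_fisherS_eq hpos hK, cS]
  simp only [Matrix.trace_fin_two, Matrix.mul_apply, Fin.sum_univ_two, weight_symm hG, h]
  ring

theorem Z_b (hK : 0 < c.K) {B : Fin 2 → (H →L[ℂ] H)} {v : Fin 2 → ℝ}
    (hB : ∀ j, c.φ (B j) = pauliMat (-c.r * c.b₃ v j) (c.b₁ v j) (c.b₂ v j) (c.b₃ v j)) :
    M.Z θ B = hermMat (c.A 0 0 + c.K * (v 0 * v 0)) (c.A 0 1 + c.K * (v 0 * v 1))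
      (c.A 1 1 + c.K * (v 1 * v 1))
      (-(c.r * ((1 - c.r ^ 2) * c.n₃ / c.K - (v 0 * c.z 0 + v 1 * c.z 1)))) := by
  rw [c.Z_eq hB, ← c.cross_b hK, ← c.metric_b hK, ← c.metric_b hK, ← c.metric_b hK]
  congr 1 <;> ring

/-- The dual SLDs are the centred observables with v = 0. -/
theorem CZ_eq [FiniteDimensional ℂ H] (hpos : IsStrictlyPositive (M.state θ)) (hK : 0 < c.K)
    {G : Matrix (Fin 2) (Fin 2) ℝ} (hG : G.PosDef) : M.CZ θ G = c.cS G + c.imTerm G := by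
  have h : ∀ j, c.φ (M.dualSLD θ j)
      = pauliMat (-c.r * c.b₃ 0 j) (c.b₁ 0 j) (c.b₂ 0 j) (c.b₃ 0 j) := by
    intro j
    rw [QuantumModel.dualSLD, Fin.sum_univ_two, map_add, map_smul, map_smul, c.sld_eq hpos,
      c.sld_eq hpos, c.inv_fisherS_eq hpos hK, smul_pauliMat, smul_pauliMat, pauliMat_add]
    simp only [b₁, b₂, b₃, Pi.zero_apply]
    congr 1 <;> ring
  rw [QuantumModel.CZ, c.Z_b hK h, weightedBound_hermMat hG, abs_neg, cS, imTerm]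
  simp

/-! ### Reduction of the Holevo problem to two real variables -/

theorem objective_mem_holevoValues (hK : 0 < c.K) {G : Matrix (Fin 2) (Fin 2) ℝ} (hG : G.PosDef)
    (v : Fin 2 → ℝ) : c.objective G v ∈ M.holevoValues θ G := by
  let B : Fin 2 → (H →L[ℂ] H) := fun j =>
    c.φ.symm (pauliMat (-c.r * c.b₃ v j) (c.b₁ v j) (c.b₂ v j) (c.b₃ v j))
  have hB : ∀ j, c.φ (B j) = pauliMat (-c.r * c.b₃ v j) (c.b₁ v j) (c.b₂ v j) (c.b₃ v j) :=
    fun j => StarAlgEquiv.apply_symm_apply _ _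
  obtain ⟨V, hV, htr⟩ := exists_hermMat_le hG (c.A 0 0 + c.K * (v 0 * v 0))
    (c.A 0 1 + c.K * (v 0 * v 1)) (c.A 1 1 + c.K * (v 1 * v 1))
    (-(c.r * ((1 - c.r ^ 2) * c.n₃ / c.K - (v 0 * c.z 0 + v 1 * c.z 1))))
  refine ⟨V, B, fun j => (isSelfAdjoint_pauliMat _ _ _ _).map c.φ.symm, fun i j => ?_, ?_, ?_⟩
  · rw [c.opTrace_pderiv_mul (hB j), c.pairing_b hK]
    split_ifs <;> simp
  · rwa [c.Z_b hK hB]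
  · rw [htr, abs_neg, objective, cS]
    ring

theorem exists_objective_le (hK : 0 < c.K) {G : Matrix (Fin 2) (Fin 2) ℝ} (hG : G.PosDef)
    {a : ℝ} (ha : a ∈ M.holevoValues θ G) : ∃ v, c.objective G v ≤ a := by
  obtain ⟨V, B, hsa, hub, hV, rfl⟩ := ha
  choose w p q s hB using fun j => exists_eq_pauliMat ((hsa j).map c.φ)
  obtain ⟨v, hv⟩ := c.exists_eq_b hK (p := p) (q := q) (s := s) fun i j => by
    have := hub i j
    rw [c.opTrace_pderiv_mul (hB j)] at this
    split_ifs at this ⊢ <;> exact_mod_cast this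
  refine ⟨v, ?_⟩
  rw [c.Z_eq hB] at hV
  have h := le_trace_of_hermMat_le hG hV
  have hc := c.cross_b hK v
  have h00 := c.metric_b hK v 0 0
  have h01 := c.metric_b hK v 0 1
  have h11 := c.metric_b hK v 1 1
  simp only [← (hv _).1, ← (hv _).2.1, ← (hv _).2.2] at hc h00 h01 h11
  rw [hc, abs_neg] at h
  -- Uncentred scalar parts add (w + r s)(w + r s)ᵀ to Re Z and leave Im Z unchanged; their cost is
  -- nonnegative and is dropped.
  have hw := weight_quadratic_nonneg hG (w 0 + c.r * s 0) (w 1 + c.r * s 1)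
  refine le_trans ?_ h
  rw [objective, cS, add_le_add_iff_right]
  linear_combination hw - G 0 0 * h00 - 2 * G 0 1 * h01 - G 1 1 * h11

/-! ### Duality between the objective and the β bounds -/

theorem adjForm_nonneg {G : Matrix (Fin 2) (Fin 2) ℝ} (hG : G.PosDef) : 0 ≤ c.adjForm G := by
  have := weight_quadratic_nonneg hG (c.z 1) (-c.z 0)
  unfold adjForm
  linarith

theorem imTerm_nonneg (G : Matrix (Fin 2) (Fin 2) ℝ) : 0 ≤ c.imTerm G := by
  unfold imTerm
  positivity

theorem reTerm_nonneg (hK : 0 < c.K) {G : Matrix (Fin 2) (Fin 2) ℝ} (hG : G.PosDef) :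
    0 ≤ c.reTerm G := by
  have := c.adjForm_nonneg hG
  unfold reTerm
  positivity

/-- Weak duality: the `β` bounds are lower bounds for the Holevo problem. -/
theorem le_objective (hK : 0 < c.K) {G : Matrix (Fin 2) (Fin 2) ℝ} (hG : G.PosDef) {β : ℝ}
    (hβ : β ∈ Icc (0 : ℝ) 1) (v : Fin 2 → ℝ) :
    c.cS G + β * c.imTerm G - β ^ 2 * c.reTerm G ≤ c.objective G v := by
  have hcs := weight_cauchy_schwarz hG (v 0) (v 1) (c.z 0) (c.z 1)
  have hX := weight_quadratic_nonneg hG (v 0) (v 1)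
  have hY := c.adjForm_nonneg hG
  rw [imTerm, reTerm, objective]
  change _ ≤ _ * c.adjForm G at hcs
  have hg := Real.sqrt_nonneg G.det
  rw [← Real.sq_sqrt hG.det_pos.le] at hcs
  generalize √G.det = g at *
  generalize c.adjForm G = Y at *
  generalize G 0 0 * v 0 ^ 2 + 2 * G 0 1 * v 0 * v 1 + G 1 1 * v 1 ^ 2 = X at *
  generalize v 0 * c.z 0 + v 1 * c.z 1 = u at *
  generalize (1 - c.r ^ 2) * c.n₃ / c.K = κ at *
  have h1 : |c.r * κ| ≤ |c.r * (κ - u)| + |c.r * u| := by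
    have := abs_add_le (c.r * (κ - u)) (c.r * u)
    rwa [show c.r * (κ - u) + c.r * u = c.r * κ by ring] at this
  -- Cauchy–Schwarz bounds the squared left side by 4ab, where a and b are the summands on the
  -- right; then 4ab ≤ (a + b)².
  have h2 : 2 * β * (g * |c.r * u|) ≤ c.K * X + β ^ 2 * (c.r ^ 2 * Y / c.K) := by
    have hnn : 0 ≤ c.K * X + β ^ 2 * (c.r ^ 2 * Y / c.K) := by positivity
    refine (abs_le_of_sq_le_sq' ?_ hnn).2
    have e1 : (2 * β * (g * |c.r * u|)) ^ 2 = 4 * β ^ 2 * c.r ^ 2 * (g ^ 2 * u ^ 2) := by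
      rw [mul_pow, mul_pow g, sq_abs]
      ring
    have e2 : 4 * β ^ 2 * c.r ^ 2 * (g ^ 2 * u ^ 2) ≤ 4 * β ^ 2 * c.r ^ 2 * (X * Y) :=
      mul_le_mul_of_nonneg_left hcs (by positivity)
    have e3 : 4 * β ^ 2 * c.r ^ 2 * (X * Y) = 4 * (c.K * X) * (β ^ 2 * (c.r ^ 2 * Y / c.K)) := by
      field_simp
    rw [e1]
    linarith [sq_nonneg (c.K * X - β ^ 2 * (c.r ^ 2 * Y / c.K))]
  have h3 : β * (2 * g * |c.r * κ|) ≤ β * (2 * g * (|c.r * (κ - u)| + |c.r * u|)) := by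
    have := hβ.1
    gcongr
  have h4 : β * (2 * g * |c.r * (κ - u)|) ≤ 2 * g * |c.r * (κ - u)| :=
    mul_le_of_le_one_left (by positivity) hβ.2
  linarith

/-- The first order condition for the Holevo problem. -/
theorem exists_objective_eq (hK : 0 < c.K) {G : Matrix (Fin 2) (Fin 2) ℝ} (hG : G.PosDef) {β : ℝ}
    (hle : 2 * β * c.reTerm G ≤ c.imTerm G) (hβ : β = 1 ∨ 2 * β * c.reTerm G = c.imTerm G) :
    ∃ v, c.objective G v = c.cS G + β * c.imTerm G - β ^ 2 * c.reTerm G := by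
  have hd := hG.det_pos
  have hg : 0 < √G.det := Real.sqrt_pos.2 hd
  have hgs : √G.det ^ 2 = G 0 0 * G 1 1 - G 0 1 ^ 2 := by rw [Real.sq_sqrt hd.le, weight_det hG]
  -- A sign taken as ±1 even at zero, so that σ² = 1 always holds.
  obtain ⟨σ, hσ, hσn⟩ : ∃ σ : ℝ, σ ^ 2 = 1 ∧
      σ * |c.r * ((1 - c.r ^ 2) * c.n₃ / c.K)| = c.r * ((1 - c.r ^ 2) * c.n₃ / c.K) := by
    rcases le_total 0 (c.r * ((1 - c.r ^ 2) * c.n₃ / c.K)) with h | h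
    · exact ⟨1, by norm_num, by rw [abs_of_nonneg h, one_mul]⟩
    · exact ⟨-1, by norm_num, by rw [abs_of_nonpos h]; ring⟩
  have ht : c.imTerm G = 2 * √G.det * |c.r * ((1 - c.r ^ 2) * c.n₃ / c.K)| := rfl
  -- The equality case of the dual bound: v ∝ adj(G) z gives equality in Cauchy–Schwarz, and the
  -- factor balances the two summands.
  refine ⟨![β * σ * c.r / (√G.det * c.K) * (G 1 1 * c.z 0 - G 0 1 * c.z 1),
    β * σ * c.r / (√G.det * c.K) * (G 0 0 * c.z 1 - G 0 1 * c.z 0)], ?_⟩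
  simp only [objective, Matrix.cons_val_zero, Matrix.cons_val_one]
  have e1 : c.r * ((1 - c.r ^ 2) * c.n₃ / c.K
      - (β * σ * c.r / (√G.det * c.K) * (G 1 1 * c.z 0 - G 0 1 * c.z 1) * c.z 0
        + β * σ * c.r / (√G.det * c.K) * (G 0 0 * c.z 1 - G 0 1 * c.z 0) * c.z 1))
      = σ * ((c.imTerm G - 2 * β * c.reTerm G) / (2 * √G.det)) := by
    rw [mul_sub, ← hσn, ht, reTerm, adjForm]
    field_simp
    ring
  have e2 : |σ| = 1 := by
    rw [← sq_eq_sq₀ (abs_nonneg _) zero_le_one, sq_abs, hσ, one_pow]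
  rw [e1, abs_mul, e2, abs_of_nonneg (div_nonneg (by linarith) (by positivity))]
  have e3 : c.K * (G 0 0 * (β * σ * c.r / (√G.det * c.K) * (G 1 1 * c.z 0 - G 0 1 * c.z 1)) ^ 2
      + 2 * G 0 1 * (β * σ * c.r / (√G.det * c.K) * (G 1 1 * c.z 0 - G 0 1 * c.z 1))
        * (β * σ * c.r / (√G.det * c.K) * (G 0 0 * c.z 1 - G 0 1 * c.z 0))
      + G 1 1 * (β * σ * c.r / (√G.det * c.K) * (G 0 0 * c.z 1 - G 0 1 * c.z 0)) ^ 2)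
      = β ^ 2 * c.reTerm G := by
    have : ∀ m a b : ℝ, c.K * (G 0 0 * (m * a) ^ 2 + 2 * G 0 1 * (m * a) * (m * b)
        + G 1 1 * (m * b) ^ 2)
        = m ^ 2 * c.K * (G 0 0 * a ^ 2 + 2 * G 0 1 * a * b + G 1 1 * b ^ 2) := by
      intros
      ring
    rw [this]
    have h2 : G 0 0 * (G 1 1 * c.z 0 - G 0 1 * c.z 1) ^ 2
        + 2 * G 0 1 * (G 1 1 * c.z 0 - G 0 1 * c.z 1) * (G 0 0 * c.z 1 - G 0 1 * c.z 0)
        + G 1 1 * (G 0 0 * c.z 1 - G 0 1 * c.z 0) ^ 2 = √G.det ^ 2 * c.adjForm G := by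
      rw [hgs, adjForm]
      ring
    rw [h2, reTerm, div_pow, mul_pow, mul_pow, hσ]
    field_simp
  rw [e3]
  field_simp
  -- The remaining gap is (β - 1)(2βQ - T): complementary slackness.
  rcases hβ with rfl | hβ
  · ring
  · linear_combination (β - 1) * hβ


/-! ### The optimal β -/

theorem betaHat_eq [FiniteDimensional ℂ H] (hθ : θ ∈ M.params)
    (hpos : IsStrictlyPositive (M.state θ)) (hK : 0 < c.K) {G : Matrix (Fin 2) (Fin 2) ℝ}
    (hG : G.PosDef) :
    M.betaHat θ G =
      if c.reTerm G ≠ 0 then ((c.imTerm G / (2 * c.reTerm G) : ℝ) : EReal) else ⊤ := by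
  have hR := c.inv_fisherBeta_eq hpos hK (β := 1) ⟨zero_le_one, le_rfl⟩
  rw [← M.fisherR_eq_fisherBeta_one hθ hpos] at hR
  have hdiff : (M.fisherS θ)⁻¹ - (M.fisherR θ)⁻¹.map Complex.re
      = !![c.r ^ 2 * c.z 1 ^ 2 / c.K, -(c.r ^ 2 * (c.z 0 * c.z 1) / c.K);
           -(c.r ^ 2 * (c.z 0 * c.z 1) / c.K), c.r ^ 2 * c.z 0 ^ 2 / c.K] := by
    rw [hR, c.inv_fisherS_eq hpos hK, map_re_hermMat]
    have h : c.A 1 0 = c.A 0 1 := rfl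
    ext i j
    fin_cases i <;> fin_cases j <;> simp [h]
  have hre : (G * ((M.fisherS θ)⁻¹ - (M.fisherR θ)⁻¹.map Complex.re)).trace = c.reTerm G := by
    rw [hdiff, reTerm, adjForm]
    simp only [Matrix.trace_fin_two, Matrix.mul_apply, Fin.sum_univ_two, weight_symm hG,
      Matrix.of_apply, Matrix.cons_val]
    ring
  have him : traceAbs G ((M.fisherR θ)⁻¹.map Complex.im) = c.imTerm G := by
    rw [hR, map_im_hermMat, traceAbs_antisymm hG, abs_neg, imTerm, one_mul]
  -- The difference matrix is a rotated copy of (r²/K) z zᵀ, so positive definiteness of G lets its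
  -- weighted trace detect whether it vanishes.
  have hne : (M.fisherS θ)⁻¹ ≠ (M.fisherR θ)⁻¹.map Complex.re ↔ c.reTerm G ≠ 0 := by
    rw [not_iff_not]
    constructor
    · intro h
      rw [← hre, h, sub_self, mul_zero, Matrix.trace_zero]
    · intro h
      rw [← sub_eq_zero, hdiff]
      rw [reTerm, div_eq_zero_iff, or_iff_left hK.ne', mul_eq_zero] at h
      rcases h with h | h
      · ext i j
        fin_cases i <;> fin_cases j <;> simp [h]
      · obtain ⟨h1, h0⟩ := weight_quadratic_eq_zero hG (a := c.z 1) (b := -c.z 0) (by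
          rw [← h, adjForm]
          ring)
        rw [neg_eq_zero] at h0
        ext i j
        fin_cases i <;> fin_cases j <;> simp [h0, h1]
  rw [QuantumModel.betaHat, hre, him]
  simp only [hne]

theorem one_le_betaHat_iff [FiniteDimensional ℂ H] (hθ : θ ∈ M.params)
    (hpos : IsStrictlyPositive (M.state θ)) (hK : 0 < c.K) {G : Matrix (Fin 2) (Fin 2) ℝ}
    (hG : G.PosDef) : 1 ≤ M.betaHat θ G ↔ 2 * c.reTerm G ≤ c.imTerm G := by
  rw [c.betaHat_eq hθ hpos hK hG]
  split_ifs with h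
  · have hq : 0 < c.reTerm G := lt_of_le_of_ne (c.reTerm_nonneg hK hG) h.symm
    rw [← EReal.coe_one, EReal.coe_le_coe_iff, one_le_div (by positivity)]
  · have := c.imTerm_nonneg G
    rw [not_not] at h
    simpa [h] using this

/-- Strict inequality excludes Q = 0, hence the value ⊤, whose `toReal` would be 0. -/
theorem toReal_betaHat [FiniteDimensional ℂ H] (hθ : θ ∈ M.params)
    (hpos : IsStrictlyPositive (M.state θ)) (hK : 0 < c.K) {G : Matrix (Fin 2) (Fin 2) ℝ}
    (hG : G.PosDef) (h : c.imTerm G < 2 * c.reTerm G) :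
    (M.betaHat θ G).toReal = c.imTerm G / (2 * c.reTerm G) := by
  have := c.imTerm_nonneg G
  rw [c.betaHat_eq hθ hpos hK hG, if_pos (by linarith), EReal.toReal_coe]

/-- Strong duality for the Holevo problem, at a critical point `β` of the `β` bounds. -/
theorem isLeast_and_isGreatest [FiniteDimensional ℂ H] (hpos : IsStrictlyPositive (M.state θ))
    (hK : 0 < c.K) {G : Matrix (Fin 2) (Fin 2) ℝ} (hG : G.PosDef) {β : ℝ}
    (hβ : β ∈ Icc (0 : ℝ) 1) (hle : 2 * β * c.reTerm G ≤ c.imTerm G)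
    (hcrit : β = 1 ∨ 2 * β * c.reTerm G = c.imTerm G) :
    IsLeast (M.holevoValues θ G) (M.Cbeta θ G β) ∧
      IsGreatest (M.Cbeta θ G '' Icc 0 1) (M.Cbeta θ G β) := by
  obtain ⟨v, hv⟩ := c.exists_objective_eq hK hG hle hcrit
  rw [← c.Cbeta_eq hpos hK hG hβ] at hv
  refine ⟨⟨hv ▸ c.objective_mem_holevoValues hK hG v, fun a ha => ?_⟩, ⟨β, hβ, rfl⟩, ?_⟩
  · obtain ⟨u, hu⟩ := c.exists_objective_le hK hG ha
    rw [c.Cbeta_eq hpos hK hG hβ]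
    exact (c.le_objective hK hG hβ u).trans hu
  · rintro _ ⟨γ, hγ, rfl⟩
    rw [c.Cbeta_eq hpos hK hG hγ, ← hv]
    exact c.le_objective hK hG hγ v

end BlochCoords

end QuantumEstimation






theorem mainTheorem7 {H : Type*} [NormedAddCommGroup H] [InnerProductSpace ℂ H] [CompleteSpace H]
    (hdim : Module.finrank ℂ H = 2)
    (M : QuantumEstimation.QuantumModel 2 H) (θ₀ : Fin 2 → ℝ) (hθ₀ : θ₀ ∈ M.params)
    (hfaithful : IsStrictlyPositive (M.state θ₀))
    (hregular : LinearIndependent ℝ (M.pderiv θ₀))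
    (G : Matrix (Fin 2) (Fin 2) ℝ) (hG : G.PosDef) :
    IsLeast (M.holevoValues θ₀ G) (M.holevoBound θ₀ G) ∧
    IsGreatest (M.Cbeta θ₀ G '' Set.Icc 0 1) (M.holevoBound θ₀ G) ∧
    (1 ≤ M.betaHat θ₀ G → M.holevoBound θ₀ G = M.Cbeta θ₀ G 1) ∧
    (M.betaHat θ₀ G < 1 → M.holevoBound θ₀ G = M.Cbeta θ₀ G (M.betaHat θ₀ G).toReal) ∧
    (1 ≤ M.betaHat θ₀ G ↔ (M.CZ θ₀ G + M.CS θ₀ G) / 2 ≤ M.CR θ₀ G) ∧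
    M.Cbeta θ₀ G 1 = M.CR θ₀ G ∧
    (M.betaHat θ₀ G < 1 → M.CR θ₀ G < M.CZ θ₀ G ∧
      M.Cbeta θ₀ G (M.betaHat θ₀ G).toReal = M.CR θ₀ G + M.suzukiS θ₀ G) ∧
    M.holevoBound θ₀ G =
      if (M.CZ θ₀ G + M.CS θ₀ G) / 2 ≤ M.CR θ₀ G then M.CR θ₀ G
      else M.CR θ₀ G + M.suzukiS θ₀ G := by
  have : FiniteDimensional ℂ H := Module.finite_of_finrank_pos (by omega)
  obtain ⟨c⟩ := QuantumEstimation.nonempty_blochCoords hdim M hθ₀ hfaithful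
  have hK := c.K_pos hregular
  have hβ := c.one_le_betaHat_iff hθ₀ hfaithful hK hG
  have ht := c.imTerm_nonneg G
  have hR : M.Cbeta θ₀ G 1 = M.CR θ₀ G := by
    rw [QuantumEstimation.QuantumModel.CR, M.fisherR_eq_fisherBeta_one hθ₀ hfaithful]
    rfl
  have hR' : M.CR θ₀ G = c.cS G + c.imTerm G - c.reTerm G := by
    rw [← hR, c.Cbeta_eq hfaithful hK hG ⟨zero_le_one, le_rfl⟩]
    ring
  have hS := c.CS_eq hfaithful hK hG
  have hZ := c.CZ_eq hfaithful hK hG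
  have hcond : 1 ≤ M.betaHat θ₀ G ↔ (M.CZ θ₀ G + M.CS θ₀ G) / 2 ≤ M.CR θ₀ G := by
    rw [hβ, hR', hS, hZ]
    constructor <;> intro <;> linarith
  -- The vertex of the parabola lies either at or beyond β = 1 (or Q = 0), or inside [0, 1).
  by_cases h : 2 * c.reTerm G ≤ c.imTerm G
  · obtain ⟨h1, h2⟩ := c.isLeast_and_isGreatest hfaithful hK hG (β := 1) ⟨zero_le_one, le_rfl⟩
      (by linarith) (Or.inl rfl)
    have hH : M.holevoBound θ₀ G = M.Cbeta θ₀ G 1 := h1.csInf_eq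
    have hb := hβ.2 h
    rw [hH]
    exact ⟨h1, h2, fun _ => rfl, fun h' => absurd hb h'.not_ge, hcond, hR,
      fun h' => absurd hb h'.not_ge, by rw [if_pos (hcond.1 hb), hR]⟩
  · have hlt := not_le.1 h
    have hq : 0 < c.reTerm G := by linarith
    have hb : ¬ 1 ≤ M.betaHat θ₀ G := fun h' => h (hβ.1 h')
    have htr := c.toReal_betaHat hθ₀ hfaithful hK hG hlt
    have hmem : c.imTerm G / (2 * c.reTerm G) ∈ Set.Icc (0 : ℝ) 1 :=
      ⟨by positivity, (div_le_one (by positivity)).2 hlt.le⟩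
    have hcrit : 2 * (c.imTerm G / (2 * c.reTerm G)) * c.reTerm G = c.imTerm G := by field_simp
    obtain ⟨h1, h2⟩ := c.isLeast_and_isGreatest hfaithful hK hG hmem hcrit.le (Or.inr hcrit)
    have hH : M.holevoBound θ₀ G = _ := h1.csInf_eq
    have hsuz : M.Cbeta θ₀ G (c.imTerm G / (2 * c.reTerm G))
        = M.CR θ₀ G + M.suzukiS θ₀ G := by
      -- Both sides equal cS + T²/(4Q), as the correction is (Q - T/2)²/Q.
      have hden : c.cS G + c.imTerm G - (c.cS G + c.imTerm G - c.reTerm G) = c.reTerm G := by ring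
      rw [c.Cbeta_eq hfaithful hK hG hmem, QuantumEstimation.QuantumModel.suzukiS, hR', hS, hZ,
        hden]
      field_simp
      ring
    rw [hH, htr]
    exact ⟨h1, h2, fun h' => absurd h' hb, fun _ => rfl, hcond, hR,
      fun _ => ⟨by rw [hR', hZ]; linarith, hsuz⟩, by rw [if_neg fun h' => hb (hcond.2 h'), hsuz]⟩
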